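/- **Notation.** Let $\rho:\mathbb N\to(0,\infty)$ be a weight function, i.e. $\sum_m\rho(m)m^p<\infty$ for all $p\ge 0$. Let $C_\rho=\{f:\mathbb N\to\mathbb R : f(m)\rho(m)\to 0\}$ with norm $\|f\|=\sup_m|f(m)|\rho(m)$; its dual is $J_\rho=\{x\in\mathbb R^{\mathbb N}:\sum_m|x_m|/\rho(m)<\infty\}$. Let $R_\rho\subseteq C_\rho$ be the closure of the space of polynomials (as sequences $(p(0),p(1),\dots)$), and let $\hat J_\rho=R_\rho^*$, a quotient of $J_\rho$: an element $z$ of $\hat J_\rho$ is identified with the class of all $x\in J_\rho$ such that $\langle f,z\rangle=\sum_m x_mf(m)$ for all $f\in R_\rho$. A *$\hat J_\rho$-graphon* is a symmetric weak-$*$ measurable map $W:[0,1]^2\to\hat J_\rho$ such that $(x,y)\mapsto\|W(x,y)\|$ lies in $L^p([0,1]^2)$ for all $1\le p<\infty$. We assume that $W$ is *probability-valued*: for almost all $(x,y)$, the class $W(x,y)$ contains a probability distribution on $\mathbb N$. Multigraphs are finite and loopless. For multigraphs $F,G$ let $t(F,G)=\hom(F,G)/|V(G)|^{|V(F)|}$,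 where $\hom(F,G)$ is the number of pairs of maps $V(F)\to V(G)$, $E(F)\to E(G)$ that respect endpoints. If $F$ has underlying simple graph $F_0$ and edge multiplicities $f_{ij}$, let $$t(F,W)=\int_{[0,1]^{V(F)}}\prod_{ij\in E(F_0)}\langle X^{f_{ij}},W(x_i,x_j)\rangle\,dx .$$ The random multigraph $\mathbb G^{\mathrm{rand}}(n,W)$ on $[n]$ is generated as follows: choose independent uniform points $x_1,\dots,x_n\in[0,1]$; for every pair $i\ne j$ select (in an arbitrary, possibly adversarial way) a probability distribution $g_{ij}$ in the class $W(x_i,x_j)$; then, given the points and the $g_{ij}$, draw the multiplicities of the edges $ij$ independently from the distributions $g_{ij}$. **Corollary.** Let $W$ be a probability-valued $\hat J_\rho$-graphon. Then for every multigraph $F$, $$t(F,\mathbb G^{\mathrm{rand}}(n,W))\to t(F,W)\qquad(n\to\infty)$$ with probability $1$, whatever the joint distribution of these random multigraphs for different $n$. Moreover, for every $F$ and almost every choice of the points, for every selection of the distributions $g_{ij}$ (which need not depend measurably on the points), the convergence holds with probability $1$ with respect to the drawing of the multiplicities. In particular, there is a sequence of multigraphs $G_n$ on $[n]$ with $t(F,G_n)\to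 t(F,W)$ for every multigraph $F$. -/

import Mathlib

open MeasureTheory ProbabilityTheory Filter Topology
open scoped unitInterval

noncomputable section

namespace MultigraphLimit

/-! ### The weighted sequence spaces -/

/-- A weight function: a positive sequence all of whose moments are finite. -/
structure WeightFunction where
  toFun : ℕ → ℝ
  pos : ∀ m, 0 < toFun m
  moments : ∀ p : ℕ, Summable fun m : ℕ => toFun m * (m : ℝ) ^ p

instance : CoeFun WeightFunction (fun _ => ℕ → ℝ) := ⟨WeightFunction.toFun⟩

/-- The linear space of all `f : ℕ → ℝ` with `f m * ρ m → 0`. -/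
def cSubmodule (ρ : WeightFunction) : Submodule ℝ (ℕ → ℝ) where
  carrier := {f | Tendsto (fun m => f m * ρ m) atTop (𝓝 0)}
  add_mem' := by
    intro f g hf hg
    have h := Tendsto.add hf hg
    simpa [add_mul] using h
  zero_mem' := by simp
  smul_mem' := by
    intro c f hf
    have h := Tendsto.const_mul c hf
    simpa [mul_assoc] using h

/-- The space `C_ρ`, as a type of its own, because its norm is not related to the topology of
pointwise convergence that `cSubmodule ρ` inherits from `ℕ → ℝ`. -/
def CSpace (ρ : WeightFunction) : Type := cSubmodule ρ

instance (ρ : WeightFunction) : AddCommGroup (CSpace ρ) :=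
  inferInstanceAs (AddCommGroup (cSubmodule ρ))

instance (ρ : WeightFunction) : Module ℝ (CSpace ρ) :=
  inferInstanceAs (Module ℝ (cSubmodule ρ))

instance (ρ : WeightFunction) : CoeFun (CSpace ρ) (fun _ => ℕ → ℝ) := ⟨fun f => f.1⟩

/-- The linear map `f ↦ f · ρ` into the space of sequences tending to zero with its
supremum norm. -/
def CSpace.mulWeight (ρ : WeightFunction) : CSpace ρ →ₗ[ℝ] ZeroAtInftyContinuousMap ℕ ℝ where
  toFun f :=
    { toFun := fun m => f m * ρ m
      continuous_toFun := continuous_of_discreteTopology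
      zero_at_infty' := by
        rw [Filter.cocompact_eq_cofinite, Nat.cofinite_eq_atTop]
        exact f.2 }
  map_add' f g := by
    ext m
    exact add_mul (f.1 m) (g.1 m) (ρ m)
  map_smul' c f := by
    ext m
    exact mul_assoc c (f.1 m) (ρ m)

theorem CSpace.mulWeight_injective (ρ : WeightFunction) :
    Function.Injective (CSpace.mulWeight ρ) := by
  intro f g h
  apply Subtype.ext
  funext m
  have hm : f.1 m * ρ m = g.1 m * ρ m := DFunLike.congr_fun h m
  exact mul_right_cancel₀ (ρ.pos m).ne' hm

/-- The norm of `C_ρ` is `‖f‖ = sup_m |f m * ρ m|`. -/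
instance (ρ : WeightFunction) : NormedAddCommGroup (CSpace ρ) :=
  NormedAddCommGroup.induced (CSpace ρ) (ZeroAtInftyContinuousMap ℕ ℝ)
    (CSpace.mulWeight ρ) (CSpace.mulWeight_injective ρ)

instance (ρ : WeightFunction) : NormedSpace ℝ (CSpace ρ) :=
  NormedSpace.induced ℝ (CSpace ρ) (ZeroAtInftyContinuousMap ℕ ℝ) (CSpace.mulWeight ρ)

/-- The monomial `X ^ p`, as the sequence `m ↦ m ^ p` in `C_ρ`. -/
def CSpace.monomial (ρ : WeightFunction) (p : ℕ) : CSpace ρ :=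
  ⟨fun m => (m : ℝ) ^ p, by
    have h := (ρ.moments p).tendsto_atTop_zero
    simpa [cSubmodule, mul_comm] using h⟩

/-- `R_ρ`: the closure in `C_ρ` of the space of (the sequences of values of) polynomials. -/
def polySpace (ρ : WeightFunction) : Submodule ℝ (CSpace ρ) :=
  (Submodule.span ℝ (Set.range (CSpace.monomial ρ))).topologicalClosure

/-- The monomial `X ^ p` as an element of `R_ρ`. -/
def monomial (ρ : WeightFunction) (p : ℕ) : polySpace ρ :=
  ⟨CSpace.monomial ρ p,
    Submodule.le_topologicalClosure _ (Submodule.subset_span ⟨p, rfl⟩)⟩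

/-- The space `Ĵ_ρ`, the Banach space dual of `R_ρ`. -/
abbrev HatJ (ρ : WeightFunction) : Type := StrongDual ℝ (polySpace ρ)

/-- The space `J_ρ` of sequences `x` with `∑ |x m| / ρ m < ∞`, the dual of `C_ρ`. -/
def JSpace (ρ : WeightFunction) : Set (ℕ → ℝ) :=
  {x | Summable fun m => |x m| / ρ m}

/-- The equivalence class of sequences in `J_ρ` that an element `z` of `Ĵ_ρ` stands for: those
sequences whose action on `R_ρ` is `z`. -/
def HatJ.toClass {ρ : WeightFunction} (z : HatJ ρ) : Set (ℕ → ℝ) :=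
  {x | x ∈ JSpace ρ ∧ ∀ f : polySpace ρ, z f = ∑' m, x m * (f : CSpace ρ) m}

/-- The sequence `x` is a probability distribution on `ℕ`. -/
def IsDistribution (x : ℕ → ℝ) : Prop :=
  (∀ m, 0 ≤ x m) ∧ HasSum x 1

/-! ### Graphons -/

/-- A `Ĵ_ρ`-graphon: a symmetric weak-* (Lebesgue) measurable function `[0,1]² → Ĵ_ρ` whose norm
lies in `L^p([0,1]²)` for all `1 ≤ p < ∞`. -/
structure Graphon (ρ : WeightFunction) where
  toFun : I → I → HatJ ρ
  symm : ∀ x y, toFun x y = toFun y x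
  weakStar_measurable : ∀ f : polySpace ρ,
    AEMeasurable (fun z : I × I => toFun z.1 z.2 f) volume
  memLp_norm : ∀ p : ENNReal, 1 ≤ p → p ≠ ⊤ →
    MemLp (fun z : I × I => ‖toFun z.1 z.2‖) p volume

instance (ρ : WeightFunction) : CoeFun (Graphon ρ) (fun _ => I → I → HatJ ρ) := ⟨Graphon.toFun⟩

/-- The value of a graphon at an unordered pair of points. -/
def Graphon.onPair {ρ : WeightFunction} (W : Graphon ρ) : Sym2 I → HatJ ρ :=
  Sym2.lift ⟨W.toFun, W.symm⟩

/-- Almost all values of `W` are equivalence classes that contain a probability distribution. -/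
def Graphon.IsProbabilityValued {ρ : WeightFunction} (W : Graphon ρ) : Prop :=
  ∀ᵐ z : I × I, ∃ x ∈ (W z.1 z.2).toClass, IsDistribution x

/-! ### Multigraphs and homomorphism densities -/

/-- A loopless multigraph on `V`, given by its edge multiplicities. -/
@[ext]
structure Multigraph (V : Type*) where
  mult : Sym2 V → ℕ
  loopless : ∀ e, e.IsDiag → mult e = 0

/-- The edges of a multigraph: the pair `e` carries `mult e` parallel edges. -/
abbrev Multigraph.Edge {V : Type*} (G : Multigraph V) : Type _ :=
  Σ e : Sym2 V, Fin (G.mult e)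

/-- Node-and-edge homomorphisms: pairs of a map of the nodes and a map of the edges that respect
the endpoints. -/
abbrev Hom {V V' : Type*} (F : Multigraph V) (G : Multigraph V') : Type _ :=
  {h : (V → V') × (F.Edge → G.Edge) // ∀ e : F.Edge, (h.2 e).1 = e.1.map h.1}

/-- The node-and-edge homomorphism density `t(F, G) = hom(F, G) / |V(G)| ^ |V(F)|`. -/
def homDensity {V V' : Type*} (F : Multigraph V) (G : Multigraph V') : ℝ :=
  (Nat.card (Hom F G) : ℝ) / (Nat.card V' : ℝ) ^ Nat.card V

/-- The homomorphism density `t(F, W)` of a multigraph in a graphon: an edge of multiplicity `p` is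
decorated by `X ^ p`, and the product is over the edges of the underlying simple graph. -/
def graphonDensity {V : Type*} [Fintype V] [DecidableEq V] {ρ : WeightFunction}
    (F : Multigraph V) (W : Graphon ρ) : ℝ :=
  ∫ x : V → I, ∏ e : Sym2 V with F.mult e ≠ 0, W.onPair (e.map x) (monomial ρ (F.mult e))

/-! ### Random multigraphs -/

/-- The edges of the complete graph on `[n]`. -/
abbrev Pair (n : ℕ) : Type := {e : Sym2 (Fin n) // ¬ e.IsDiag}

/-- `x 0, …, x (n-1)` are independent and uniformly distributed on `[0,1]`. -/
structure IsUniformSample {Ω : Type*} [MeasurableSpace Ω] (P : Measure Ω) {n : ℕ}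
    (x : Fin n → Ω → I) : Prop where
  measurable : ∀ i, Measurable (x i)
  uniform : ∀ i, P.map (x i) = volume
  indep : iIndepFun x P

/-- The decoration `g` of the complete graph on `[n]` selects, for every pair `ij`, a probability
distribution in the equivalence class `W(x_i, x_j)`. -/
def IsSelection {ρ : WeightFunction} (W : Graphon ρ) {n : ℕ} (x : Fin n → I)
    (g : Pair n → ℕ → ℝ) : Prop :=
  ∀ e : Pair n, g e ∈ (W.onPair (e.1.map x)).toClass ∧ IsDistribution (g e)

/-- The random multigraph `M` is a randomization of the complete graph decorated by the
distributions `g`: the edge multiplicities are independent, that of `e` having the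
distribution `g e`. -/
structure IsRandomization {Ω : Type*} [MeasurableSpace Ω] (P : Measure Ω) {n : ℕ}
    (g : Pair n → ℕ → ℝ) (M : Ω → Multigraph (Fin n)) : Prop where
  measurable : ∀ e : Pair n, Measurable fun ω => (M ω).mult e
  law : ∀ (e : Pair n) (m : ℕ), P.real {ω | (M ω).mult e = m} = g e m
  indep : iIndepFun (fun (e : Pair n) ω => (M ω).mult e) P

/-- The random multigraph `M` on `[n]` is generated from the points `x` and the selection `g`: the
points are independent and uniform in `[0,1]`, `g` selects distributions from the classes
`W(x_i, x_j)`, and, conditionally on the σ-algebra `𝓖` of the information used in the selection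
(which includes the points), the edge multiplicities are independent, that of `e` having the
distribution `g e`. -/
structure IsGeneratedFrom {Ω : Type*} (𝓖 : MeasurableSpace Ω) [mΩ : MeasurableSpace Ω]
    (P : Measure Ω) {ρ : WeightFunction} (W : Graphon ρ) {n : ℕ} (x : Fin n → Ω → I)
    (g : Ω → Pair n → ℕ → ℝ) (M : Ω → Multigraph (Fin n)) : Prop where
  le : 𝓖 ≤ mΩ
  sample : IsUniformSample P x
  sample_measurable : ∀ i, Measurable[𝓖] (x i)
  selection : ∀ᵐ ω ∂P, IsSelection W (fun i => x i ω) (g ω)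
  measurable : ∀ e : Pair n, Measurable fun ω => (M ω).mult e
  condLaw : ∀ K : Multigraph (Fin n),
    P[Set.indicator {ω | M ω = K} (fun _ => (1 : ℝ)) | 𝓖]
      =ᵐ[P] fun ω => ∏ e : Pair n, g ω e (K.mult e)

/-- The random multigraph `M` on `[n]` is a realization of `G^rand(n, W)`. -/
def IsWRandomMultigraph {Ω : Type*} [mΩ : MeasurableSpace Ω] (P : Measure Ω)
    {ρ : WeightFunction} (W : Graphon ρ) {n : ℕ} (M : Ω → Multigraph (Fin n)) : Prop :=
  ∃ (𝓖 : MeasurableSpace Ω) (x : Fin n → Ω → I) (g : Ω → Pair n → ℕ → ℝ),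
    @IsGeneratedFrom Ω 𝓖 mΩ P ρ W n x g M

end MultigraphLimit

end

open MultigraphLimit

/-! A fourth moment argument in which the edge multiplicities enter only through their moments.
Given the points, the expectation of a polynomial in the multiplicities is `condMoment`. It depends
only on the numbers `⟨X ^ p, W (x_i, x_j)⟩`, hence on the classes and not on the distributions
selected from them. The adversary therefore has no influence on it, and the selection need not be
measurable. Averaging over the points gives the linear functional `meanMoment`. It is monotone
(`meanMoment_mono`) and multiplicative over disjoint sets of nodes (`meanMoment_mul`).

By `card_hom`, `t(F, G) - t(F, W)` is `n ^ (-k)` times the sum over node maps `φ` of the deviations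
`homPoly F φ - t(F, W)`, and these have mean zero for injective `φ`. In the fourth power a quadruple
of maps contributes nothing if one of them is injective and disjoint from the others. The remaining,
entangled, quadruples satisfy two separate coincidences, so there are `O(n ^ (4k - 2))` of them
(`card_isEntangled_le`), and each contributes a bounded amount (`abs_meanMoment_prod_le`). The
fourth moment is thus `O(n⁻²)`, which is summable; the second moment would only give `O(n⁻¹)`.

Hence the sum over `n` of the fourth powers has finite expectation and is almost surely finite,
whatever the joint law. Conditionally on the points, the sum of the conditional fourth moments is
finite for almost all points, and the same argument then applies to every selection at once. A
single sequence for all `F` exists because there are only countably many `F`. -/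

noncomputable section

namespace MultigraphLimit

/-! ### Measurable versions of the moments of a graphon -/

section Moments

variable {ρ : WeightFunction} (W : Graphon ρ)

/-- A measurable symmetric version of `(x, y) ↦ ⟨X ^ p, W (x, y)⟩`, equal to `1` for `p = 0`. -/
def Graphon.moment (p : ℕ) : Sym2 I → ℝ :=
  -- The pairing with `X ^ 0` is `1` only almost everywhere; forcing it makes absent edges
  -- contribute the factor `1` at every point. The measurable version need not be symmetric, hence
  -- `min` and `max`.
  if p = 0 then fun _ => 1 else
    Sym2.lift ⟨fun x y => (W.weakStar_measurable (monomial ρ p)).mk _ (min x y, max x y),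
      fun x y => by simp only [min_comm, max_comm]⟩

@[simp]
theorem Graphon.moment_zero (e : Sym2 I) : W.moment 0 e = 1 := by
  simp [Graphon.moment]

theorem Graphon.measurable_moment (p : ℕ) :
    Measurable fun z : I × I => W.moment p s(z.1, z.2) := by
  by_cases hp : p = 0
  · subst hp
    simp
  · simp only [Graphon.moment, hp, if_false, Sym2.lift_mk]
    exact (W.weakStar_measurable (monomial ρ p)).measurable_mk.comp
      ((measurable_fst.min measurable_snd).prodMk (measurable_fst.max measurable_snd))

theorem ae_pair_symm {q : I → I → Prop} (h : ∀ᵐ z : I × I, q z.1 z.2) :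
    ∀ᵐ z : I × I, q z.2 z.1 := by
  have hs : MeasurePreserving (Prod.swap : I × I → I × I) volume volume :=
    Measure.measurePreserving_swap
  exact hs.quasiMeasurePreserving.ae h

/-- Each term is `g m / ρ m`, absolutely summable, times `ρ m * m ^ p`, which is bounded. -/
theorem HatJ.summable_moment {ρ : WeightFunction} {z : HatJ ρ} {g : ℕ → ℝ} (hg : g ∈ z.toClass)
    (p : ℕ) : Summable fun m => g m * (m : ℝ) ^ p := by
  have hJ : Summable fun m => |g m| / ρ m := hg.1
  have hb := (ρ.moments p).tendsto_atTop_zero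
  obtain ⟨C, hC⟩ := hb.bddAbove_range
  refine Summable.of_norm_bounded (hJ.mul_right C) fun m => ?_
  have h1 : ρ m * (m : ℝ) ^ p ≤ C := hC ⟨m, rfl⟩
  have h2 : |g m| / ρ m * (ρ m * (m : ℝ) ^ p) = |g m| * (m : ℝ) ^ p := by
    field_simp [(ρ.pos m).ne']
  rw [Real.norm_eq_abs, abs_mul, abs_of_nonneg (by positivity : (0 : ℝ) ≤ (m : ℝ) ^ p), ← h2]
  exact mul_le_mul_of_nonneg_left h1 (div_nonneg (abs_nonneg _) (ρ.pos m).le)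

theorem HatJ.hasSum_moment {ρ : WeightFunction} {z : HatJ ρ} {g : ℕ → ℝ} (hg : g ∈ z.toClass)
    (p : ℕ) : HasSum (fun m => g m * (m : ℝ) ^ p) (z (monomial ρ p)) := by
  rw [hg.2 (monomial ρ p)]
  exact (HatJ.summable_moment hg p).hasSum

theorem HatJ.apply_monomial_zero {ρ : WeightFunction} {z : HatJ ρ} {g : ℕ → ℝ}
    (hg : g ∈ z.toClass) (hg' : IsDistribution g) : z (monomial ρ 0) = 1 := by
  have h := HatJ.hasSum_moment hg 0
  simp only [pow_zero, mul_one] at h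
  exact h.unique hg'.2

variable {W} in
theorem Graphon.IsProbabilityValued.moment_ae (hW : W.IsProbabilityValued) :
    ∀ᵐ z : I × I, ∀ p, W.moment p s(z.1, z.2) = W z.1 z.2 (monomial ρ p) := by
  rw [ae_all_iff]
  intro p
  by_cases hp : p = 0
  · subst hp
    filter_upwards [hW] with z ⟨g, hg, hg'⟩
    rw [HatJ.apply_monomial_zero hg hg', W.moment_zero]
  · have h1 := (W.weakStar_measurable (monomial ρ p)).ae_eq_mk
    -- The version is read at `(min, max)`, so agreement is needed at `z` and at its swap.
    have h2 := ae_pair_symm (q := fun x y => W x y (monomial ρ p) =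
      (W.weakStar_measurable (monomial ρ p)).mk _ (x, y)) h1
    filter_upwards [h1, h2] with z h1 h2
    simp only [Graphon.moment, hp, if_false, Sym2.lift_mk]
    rcases le_total z.1 z.2 with h | h
    · rw [min_eq_left h, max_eq_right h]
      exact h1.symm
    · rw [min_eq_right h, max_eq_left h, W.symm]
      exact h2.symm

variable {W} in
theorem Graphon.IsProbabilityValued.memLp_moment (hW : W.IsProbabilityValued) (p : ℕ)
    {q : ENNReal} (hq : 1 ≤ q) (hq' : q ≠ ⊤) :
    MemLp (fun z : I × I => W.moment p s(z.1, z.2)) q volume := by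
  refine MemLp.of_le_mul (c := ‖monomial ρ p‖) (W.memLp_norm q hq hq')
    (W.measurable_moment p).aestronglyMeasurable ?_
  filter_upwards [hW.moment_ae] with z hz
  rw [hz, Real.norm_of_nonneg (norm_nonneg (W z.1 z.2)), mul_comm]
  exact (W z.1 z.2).le_opNorm _

/-- The unordered pair `e` behaves well for the graphon: its class contains a distribution and the
measurable versions of the moments are the true ones. -/
def Graphon.IsRegularAt (e : Sym2 I) : Prop :=
  (∃ g ∈ (W.onPair e).toClass, IsDistribution g) ∧
    ∀ p, W.moment p e = W.onPair e (monomial ρ p)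

variable {W} in
theorem Graphon.IsProbabilityValued.isRegularAt_ae (hW : W.IsProbabilityValued) :
    ∀ᵐ z : I × I, W.IsRegularAt s(z.1, z.2) := by
  filter_upwards [hW, hW.moment_ae] with z h1 h2
  exact ⟨h1, h2⟩

end Moments

/-! ### Independent uniform points -/

section Points

theorem measurePreserving_eval_volume {n : ℕ} (i : Fin n) :
    MeasurePreserving (fun x : Fin n → I => x i) volume volume :=
  measurePreserving_eval (fun _ : Fin n => (volume : Measure I)) i

theorem volume_map_eval_pair {n : ℕ} {i j : Fin n} (hij : i ≠ j) :
    MeasurePreserving (fun x : Fin n → I => (x i, x j)) volume volume := by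
  refine ⟨by fun_prop, ?_⟩
  have h : iIndepFun (fun (i : Fin n) (x : Fin n → I) => x i) volume :=
    iIndepFun_pi (μ := fun _ : Fin n => (volume : Measure I)) (X := fun _ => id)
      fun _ => aemeasurable_id
  have h2 := (h.indepFun hij).map_prod_eq_prod_map_map (measurable_pi_apply i).aemeasurable
    (measurable_pi_apply j).aemeasurable
  rw [h2, (measurePreserving_eval_volume i).map_eq, (measurePreserving_eval_volume j).map_eq]
  rfl

theorem volume_map_comp_injective {n k : ℕ} {φ : Fin k → Fin n} (hφ : Function.Injective φ) :
    MeasurePreserving (fun x : Fin n → I => x ∘ φ) volume volume := by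
  refine ⟨by fun_prop, ?_⟩
  have h : iIndepFun (fun (i : Fin n) (x : Fin n → I) => x i) volume :=
    iIndepFun_pi (μ := fun _ : Fin n => (volume : Measure I)) (X := fun _ => id)
      fun _ => aemeasurable_id
  have h2 := (iIndepFun_iff_map_fun_eq_pi_map fun i =>
    (measurable_pi_apply (φ i)).aemeasurable).1 (h.precomp hφ)
  simp only [(measurePreserving_eval_volume _).map_eq] at h2
  exact h2

/-- Functions of disjoint blocks of independent coordinates are independent. -/
theorem integral_mul_of_disjoint {n : ℕ} {S T : Finset (Fin n)} (hST : Disjoint S T)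
    {A B : (Fin n → I) → ℝ} (hA : Measurable A) (hB : Measurable B)
    (hAS : ∀ x y : Fin n → I, (∀ i ∈ S, x i = y i) → A x = A y)
    (hBT : ∀ x y : Fin n → I, (∀ i ∈ T, x i = y i) → B x = B y) :
    ∫ x, A x * B x = (∫ x, A x) * ∫ x, B x := by
  have h : iIndepFun (fun (i : Fin n) (x : Fin n → I) => x i) volume :=
    iIndepFun_pi (μ := fun _ : Fin n => (volume : Measure I)) (X := fun _ => id)
      fun _ => aemeasurable_id
  have h2 := h.indepFun_finset S T hST fun i => by fun_prop
  have key : ∀ (S : Finset (Fin n)) (A : (Fin n → I) → ℝ), Measurable A →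
      (∀ x y : Fin n → I, (∀ i ∈ S, x i = y i) → A x = A y) →
      ∃ A' : (S → I) → ℝ, Measurable A' ∧ A = A' ∘ fun x (i : S) => x i := by
    intro S A hA hAS
    classical
    -- Coordinates outside `S` get an arbitrary value, which `A` ignores.
    refine ⟨fun y => A fun i => if hi : i ∈ S then y ⟨i, hi⟩ else 0, ?_, ?_⟩
    · refine hA.comp (measurable_pi_iff.2 fun i => ?_)
      by_cases hi : i ∈ S
      · simp only [hi, dif_pos]
        fun_prop
      · simp [hi]
    · funext x
      exact hAS _ _ fun i hi => by simp [hi]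
  obtain ⟨A', hA', rfl⟩ := key S A hA hAS
  obtain ⟨B', hB', rfl⟩ := key T B hB hBT
  exact (h2.comp hA' hB').integral_fun_mul_eq_mul_integral hA.aestronglyMeasurable
    hB.aestronglyMeasurable

variable {Ω : Type*} [MeasurableSpace Ω] {P : Measure Ω} [IsProbabilityMeasure P]

theorem IsUniformSample.measurePreserving {n : ℕ} {x : Fin n → Ω → I}
    (hx : IsUniformSample P x) : MeasurePreserving (fun ω i => x i ω) P volume := by
  refine ⟨measurable_pi_iff.2 hx.measurable, ?_⟩
  have h := (iIndepFun_iff_map_fun_eq_pi_map fun i => (hx.measurable i).aemeasurable).1 hx.indep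
  simp only [hx.uniform] at h
  exact h

end Points

/-! ### Conditional moments of the edge multiplicities, given the points -/

section CondMoments

variable {ρ : WeightFunction} (W : Graphon ρ) {n : ℕ}

/-- The conditional `p`-th moment of the multiplicity of the pair `e`, given the points `x`; the
multiplicity of a degenerate pair is `0`. -/
def edgeMoment (x : Fin n → I) (e : Sym2 (Fin n)) (p : ℕ) : ℝ :=
  if e.IsDiag then 0 ^ p else W.moment p (e.map x)

@[simp]
theorem edgeMoment_zero (x : Fin n → I) (e : Sym2 (Fin n)) : edgeMoment W x e 0 = 1 := by
  simp [edgeMoment]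

theorem measurable_edgeMoment (e : Sym2 (Fin n)) (p : ℕ) :
    Measurable fun x : Fin n → I => edgeMoment W x e p := by
  unfold edgeMoment
  induction e with
  | _ i j =>
    by_cases hij : s(i, j).IsDiag
    · simp [hij]
    · simp only [hij, if_false, Sym2.map_mk]
      exact (W.measurable_moment p).comp (g := fun z : I × I => W.moment p s(z.1, z.2))
        (f := fun x : Fin n → I => (x i, x j)) (by fun_prop)

theorem edgeMoment_congr {x y : Fin n → I} {e : Sym2 (Fin n)} (h : ∀ i ∈ e, x i = y i) (p : ℕ) :
    edgeMoment W x e p = edgeMoment W y e p := by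
  unfold edgeMoment
  rw [Sym2.map_congr h]

variable {W} in
theorem Graphon.IsProbabilityValued.memLp_edgeMoment (hW : W.IsProbabilityValued)
    (e : Sym2 (Fin n)) (p : ℕ) {q : ENNReal} (hq : 1 ≤ q) (hq' : q ≠ ⊤) :
    MemLp (fun x : Fin n → I => edgeMoment W x e p) q volume := by
  unfold edgeMoment
  induction e with
  | _ i j =>
    by_cases hij : s(i, j).IsDiag
    · simp only [hij, if_true]
      exact memLp_const _
    · simp only [hij, if_false, Sym2.map_mk]
      exact (hW.memLp_moment p hq hq').comp_measurePreserving (volume_map_eval_pair hij)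

/-- The conditional expectation, given the points `x`, of a polynomial of the edge
multiplicities. -/
def condMoment (x : Fin n → I) : MvPolynomial (Sym2 (Fin n)) ℝ →ₗ[ℝ] ℝ :=
  -- Independence given the points is built into the values on monomials; no selection enters.
  (MvPolynomial.basisMonomials (Sym2 (Fin n)) ℝ).constr ℝ fun c => ∏ e, edgeMoment W x e (c e)

theorem condMoment_monomial (x : Fin n → I) (c : Sym2 (Fin n) →₀ ℕ) (a : ℝ) :
    condMoment W x (MvPolynomial.monomial c a) = a * ∏ e, edgeMoment W x e (c e) := by
  have h : MvPolynomial.monomial c a = a • MvPolynomial.basisMonomials (Sym2 (Fin n)) ℝ c := by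
    simp [MvPolynomial.smul_monomial]
  rw [h, map_smul, condMoment, Module.Basis.constr_basis, smul_eq_mul]

theorem condMoment_eq_sum (x : Fin n → I) (p : MvPolynomial (Sym2 (Fin n)) ℝ) :
    condMoment W x p = ∑ c ∈ p.support, p.coeff c * ∏ e, edgeMoment W x e (c e) := by
  conv_lhs => rw [p.as_sum]
  simp only [map_sum, condMoment_monomial]

@[simp]
theorem condMoment_C (x : Fin n → I) (a : ℝ) : condMoment W x (MvPolynomial.C a) = a := by
  rw [MvPolynomial.C_apply, condMoment_monomial]
  simp

theorem measurable_condMoment (p : MvPolynomial (Sym2 (Fin n)) ℝ) :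
    Measurable fun x => condMoment W x p := by
  simp only [condMoment_eq_sum]
  exact Finset.measurable_fun_sum _ fun c _ =>
    (Finset.measurable_fun_prod _ fun e _ => measurable_edgeMoment W e (c e)).const_mul _

variable {W} in
-- Hölder's inequality for `N` factors in `L^N`, where `N` is the number of pairs; this is why all
-- `L^p` norms of `W` must be finite.
theorem Graphon.IsProbabilityValued.integrable_condMoment (hW : W.IsProbabilityValued)
    (p : MvPolynomial (Sym2 (Fin n)) ℝ) : Integrable fun x => condMoment W x p := by
  simp only [condMoment_eq_sum]
  refine integrable_finsetSum _ fun c _ => Integrable.const_mul ?_ _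
  rcases isEmpty_or_nonempty (Sym2 (Fin n)) with h | h
  · simp
  have hc : (Fintype.card (Sym2 (Fin n)) : ENNReal) ≠ 0 := by simp
  have h1 : (1 : ENNReal) ≤ Fintype.card (Sym2 (Fin n)) := by
    exact_mod_cast Fintype.card_pos
  have h2 := MemLp.prod' (s := Finset.univ) (f := fun e (x : Fin n → I) => edgeMoment W x e (c e))
    (p := fun _ => (Fintype.card (Sym2 (Fin n)) : ENNReal)) (μ := volume)
    fun e _ => hW.memLp_edgeMoment e (c e) h1 (by simp)
  rw [Finset.sum_const, nsmul_eq_mul, Finset.card_univ, ENNReal.mul_inv_cancel hc (by simp),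
    inv_one, memLp_one_iff_integrable] at h2
  exact h2

/-- The pairs of nodes of a set of nodes. -/
def pairsIn (S : Set (Fin n)) : Set (Sym2 (Fin n)) := {e | ∀ i ∈ e, i ∈ S}

theorem condMoment_congr {S : Set (Fin n)} {p : MvPolynomial (Sym2 (Fin n)) ℝ}
    (hp : p ∈ MvPolynomial.supported ℝ (pairsIn S)) {x y : Fin n → I}
    (h : ∀ i ∈ S, x i = y i) : condMoment W x p = condMoment W y p := by
  rw [MvPolynomial.mem_supported] at hp
  rw [condMoment_eq_sum, condMoment_eq_sum]
  refine Finset.sum_congr rfl fun c hc => ?_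
  congr 1
  refine Finset.prod_congr rfl fun e _ => ?_
  by_cases he : c e = 0
  · simp [he]
  · refine edgeMoment_congr W (fun i hi => h i ?_) _
    exact hp (Finset.mem_coe.2 ((MvPolynomial.mem_vars_iff_mem_support e).2
      ⟨c, hc, Finsupp.mem_support_iff.2 he⟩)) i hi

/-- A pair cannot lie in both `S` and `T`, so at each pair one of the two exponents is `0` and its
factor is `1`. -/
theorem condMoment_mul {S T : Set (Fin n)} (hST : Disjoint S T)
    {p q : MvPolynomial (Sym2 (Fin n)) ℝ} (hp : p ∈ MvPolynomial.supported ℝ (pairsIn S))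
    (hq : q ∈ MvPolynomial.supported ℝ (pairsIn T)) (x : Fin n → I) :
    condMoment W x (p * q) = condMoment W x p * condMoment W x q := by
  rw [MvPolynomial.mem_supported] at hp hq
  conv_lhs => rw [p.as_sum, q.as_sum, Finset.sum_mul_sum]
  rw [condMoment_eq_sum W x p, condMoment_eq_sum W x q, Finset.sum_mul_sum, map_sum]
  refine Finset.sum_congr rfl fun c hc => ?_
  rw [map_sum]
  refine Finset.sum_congr rfl fun d hd => ?_
  rw [MvPolynomial.monomial_mul, condMoment_monomial, mul_mul_mul_comm, ← Finset.prod_mul_distrib]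
  congr 1
  refine Finset.prod_congr rfl fun e _ => ?_
  by_cases hce : c e = 0
  · simp [hce]
  by_cases hde : d e = 0
  · simp [hde]
  have h1 : e ∈ pairsIn S := hp (Finset.mem_coe.2 ((MvPolynomial.mem_vars_iff_mem_support e).2
    ⟨c, hc, Finsupp.mem_support_iff.2 hce⟩))
  have h2 : e ∈ pairsIn T := hq (Finset.mem_coe.2 ((MvPolynomial.mem_vars_iff_mem_support e).2
    ⟨d, hd, Finsupp.mem_support_iff.2 hde⟩))
  exact absurd (h2 _ e.out_fst_mem) (Set.disjoint_left.1 hST (h1 _ e.out_fst_mem))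

/-- The expectation of a polynomial of the edge multiplicities. -/
def meanMoment (p : MvPolynomial (Sym2 (Fin n)) ℝ) : ℝ :=
  ∫ x : Fin n → I, condMoment W x p

/-- Independence on two levels: of the multiplicities given the points, and of the points in `S` and
in `T`. -/
theorem meanMoment_mul {S T : Finset (Fin n)} (hST : Disjoint S T)
    {p q : MvPolynomial (Sym2 (Fin n)) ℝ}
    (hp : p ∈ MvPolynomial.supported ℝ (pairsIn (S : Set (Fin n))))
    (hq : q ∈ MvPolynomial.supported ℝ (pairsIn (T : Set (Fin n)))) :
    meanMoment W (p * q) = meanMoment W p * meanMoment W q := by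
  unfold meanMoment
  simp only [condMoment_mul W (Finset.disjoint_coe.2 hST) hp hq]
  exact integral_mul_of_disjoint hST (measurable_condMoment W p) (measurable_condMoment W q)
    (fun x y h => condMoment_congr W hp fun i hi => h i hi)
    (fun x y h => condMoment_congr W hq fun i hi => h i hi)

variable {W}

theorem Graphon.IsProbabilityValued.meanMoment_add (hW : W.IsProbabilityValued)
    (p q : MvPolynomial (Sym2 (Fin n)) ℝ) :
    meanMoment W (p + q) = meanMoment W p + meanMoment W q := by
  simp only [meanMoment, map_add]
  exact integral_add (hW.integrable_condMoment p) (hW.integrable_condMoment q)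

theorem Graphon.IsProbabilityValued.meanMoment_sub (hW : W.IsProbabilityValued)
    (p q : MvPolynomial (Sym2 (Fin n)) ℝ) :
    meanMoment W (p - q) = meanMoment W p - meanMoment W q := by
  simp only [meanMoment, map_sub]
  exact integral_sub (hW.integrable_condMoment p) (hW.integrable_condMoment q)

theorem Graphon.IsProbabilityValued.meanMoment_sum (hW : W.IsProbabilityValued)
    {ι : Type*} (s : Finset ι) (p : ι → MvPolynomial (Sym2 (Fin n)) ℝ) :
    meanMoment W (∑ i ∈ s, p i) = ∑ i ∈ s, meanMoment W (p i) := by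
  simp only [meanMoment, map_sum]
  exact integral_finsetSum _ fun i _ => hW.integrable_condMoment (p i)

theorem meanMoment_smul (a : ℝ) (p : MvPolynomial (Sym2 (Fin n)) ℝ) :
    meanMoment W (a • p) = a * meanMoment W p := by
  simp only [meanMoment, map_smul, smul_eq_mul]
  exact integral_const_mul _ _

theorem meanMoment_C (a : ℝ) :
    meanMoment W (MvPolynomial.C a : MvPolynomial (Sym2 (Fin n)) ℝ) = a := by
  simp [meanMoment]

end CondMoments

/-! ### The law of the edge multiplicities for a given selection of distributions -/

section Laws

/-- A probability distribution on `ℕ` as a `PMF`. -/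
def IsDistribution.toPMF {g : ℕ → ℝ} (h : IsDistribution g) : PMF ℕ :=
  ⟨fun m => ENNReal.ofReal (g m), by
    rw [← ENNReal.ofReal_one, ← h.2.tsum_eq, ENNReal.ofReal_tsum_of_nonneg h.1 h.2.summable]
    exact ENNReal.summable.hasSum⟩

open scoped Classical in
/-- The law on `ℕ` with point probabilities `g`. -/
def distLaw (g : ℕ → ℝ) : PMF ℕ :=
  if h : IsDistribution g then h.toPMF else PMF.pure 0

theorem distLaw_apply {g : ℕ → ℝ} (hg : IsDistribution g) (m : ℕ) :
    distLaw g m = ENNReal.ofReal (g m) := by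
  rw [distLaw, dif_pos hg]
  rfl

theorem distLaw_integral_pow {ρ : WeightFunction} {z : HatJ ρ} {g : ℕ → ℝ} (hz : g ∈ z.toClass)
    (hg : IsDistribution g) (p : ℕ) :
    Integrable (fun m : ℕ => (m : ℝ) ^ p) (distLaw g).toMeasure ∧
      ∫ m, (m : ℝ) ^ p ∂(distLaw g).toMeasure = z (monomial ρ p) := by
  have hs := HatJ.hasSum_moment hz p
  have hi : Integrable (fun m : ℕ => (m : ℝ) ^ p) (distLaw g).toMeasure := by
    refine ⟨(measurable_of_countable _).aestronglyMeasurable, ?_⟩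
    rw [hasFiniteIntegral_iff_ofReal (Eventually.of_forall fun m => by positivity),
      lintegral_countable']
    have h : ∀ m : ℕ, ENNReal.ofReal ((m : ℝ) ^ p) * (distLaw g).toMeasure {m} =
        ENNReal.ofReal (g m * (m : ℝ) ^ p) := fun m => by
      rw [PMF.toMeasure_apply_singleton _ _ (measurableSet_singleton m), distLaw_apply hg,
        mul_comm, ENNReal.ofReal_mul (hg.1 m)]
    simp only [h]
    rw [← ENNReal.ofReal_tsum_of_nonneg (fun m => mul_nonneg (hg.1 m) (by positivity)) hs.summable]
    exact ENNReal.ofReal_lt_top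
  refine ⟨hi, ?_⟩
  rw [PMF.integral_eq_tsum _ _ hi, ← hs.tsum_eq]
  refine tsum_congr fun m => ?_
  rw [distLaw_apply hg, ENNReal.toReal_ofReal (hg.1 m), smul_eq_mul]

variable {ρ : WeightFunction} {W : Graphon ρ} {n : ℕ}

/-- The law of the multiplicity of the pair `e` for the selection `g`. -/
def edgeLaw (g : Pair n → ℕ → ℝ) (e : Sym2 (Fin n)) : PMF ℕ :=
  if h : e.IsDiag then PMF.pure 0 else distLaw (g ⟨e, h⟩)

/-- The joint law of the edge multiplicities for the selection `g`. -/
def multLaw (g : Pair n → ℕ → ℝ) : Measure (Sym2 (Fin n) → ℕ) :=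
  Measure.pi fun e => (edgeLaw g e).toMeasure

instance (g : Pair n → ℕ → ℝ) : IsProbabilityMeasure (multLaw g) := by
  unfold multLaw
  infer_instance

/-- All pairs of points of the sample `x` are regular for `W`. -/
def Graphon.IsRegularSample (W : Graphon ρ) (x : Fin n → I) : Prop :=
  ∀ e : Pair n, W.IsRegularAt (e.1.map x)

theorem Graphon.IsProbabilityValued.isRegularSample_ae (hW : W.IsProbabilityValued) (n : ℕ) :
    ∀ᵐ x : Fin n → I, W.IsRegularSample x := by
  unfold Graphon.IsRegularSample
  rw [ae_all_iff]
  rintro ⟨e, he⟩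
  induction e with
  | _ i j => exact (volume_map_eval_pair he).quasiMeasurePreserving.ae hW.isRegularAt_ae

theorem Graphon.IsRegularSample.exists_isSelection {x : Fin n → I} (hx : W.IsRegularSample x) :
    ∃ g, IsSelection W x g := by
  choose g hg using fun e => (hx e).1
  exact ⟨g, hg⟩

theorem edgeLaw_integral_pow {x : Fin n → I} (hx : W.IsRegularSample x) {g : Pair n → ℕ → ℝ}
    (hg : IsSelection W x g) (e : Sym2 (Fin n)) (p : ℕ) :
    Integrable (fun m : ℕ => (m : ℝ) ^ p) (edgeLaw g e).toMeasure ∧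
      ∫ m, (m : ℝ) ^ p ∂(edgeLaw g e).toMeasure = edgeMoment W x e p := by
  by_cases he : e.IsDiag
  · simp only [edgeLaw, he, dif_pos, edgeMoment, if_true, PMF.toMeasure_pure]
    exact ⟨integrable_dirac (by simp), by simp⟩
  · simp only [edgeLaw, he, edgeMoment, if_false, dif_neg, not_false_iff]
    rw [(hx ⟨e, he⟩).2 p]
    exact distLaw_integral_pow (hg ⟨e, he⟩).1 (hg ⟨e, he⟩).2 p

/-- The value does not involve `g`: monomials lie in `R_ρ`, so the class already determines all
moments. -/
theorem multLaw_integral_eval {x : Fin n → I} (hx : W.IsRegularSample x) {g : Pair n → ℕ → ℝ}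
    (hg : IsSelection W x g) (p : MvPolynomial (Sym2 (Fin n)) ℝ) :
    Integrable (fun K => MvPolynomial.eval (fun e => (K e : ℝ)) p) (multLaw g) ∧
      ∫ K, MvPolynomial.eval (fun e => (K e : ℝ)) p ∂(multLaw g) = condMoment W x p := by
  have hi : ∀ c : Sym2 (Fin n) →₀ ℕ, Integrable
      (fun K : Sym2 (Fin n) → ℕ => p.coeff c * ∏ e, (K e : ℝ) ^ c e) (multLaw g) := fun c =>
    (Integrable.fintype_prod fun e => (edgeLaw_integral_pow hx hg e (c e)).1).const_mul _
  simp only [MvPolynomial.eval_eq']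
  refine ⟨integrable_finsetSum _ fun c _ => hi c, ?_⟩
  rw [integral_finsetSum _ fun c _ => hi c, condMoment_eq_sum]
  refine Finset.sum_congr rfl fun c _ => ?_
  rw [integral_const_mul, multLaw,
    integral_fintype_prod_eq_prod (f := fun e (m : ℕ) => (m : ℝ) ^ c e)]
  simp only [(edgeLaw_integral_pow hx hg _ _).2]

theorem multLaw_singleton {g : Pair n → ℕ → ℝ} (hg : ∀ e, IsDistribution (g e))
    (K : Multigraph (Fin n)) :
    multLaw g {K.mult} = ENNReal.ofReal (∏ e : Pair n, g e (K.mult e)) := by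
  rw [multLaw, Measure.pi_singleton, ENNReal.ofReal_prod_of_nonneg fun e _ => (hg e).1 _]
  symm
  refine Fintype.prod_of_injective Subtype.val Subtype.val_injective _ _ (fun e he => ?_)
    fun e => ?_
  · have hd : e.IsDiag := by simpa using he
    rw [PMF.toMeasure_apply_singleton _ _ (measurableSet_singleton _), K.loopless e hd]
    simp [edgeLaw, hd]
  · rw [PMF.toMeasure_apply_singleton _ _ (measurableSet_singleton _), edgeLaw, dif_neg e.2,
      distLaw_apply (hg e)]

theorem multLaw_singleton_of_loop {g : Pair n → ℕ → ℝ} {K : Sym2 (Fin n) → ℕ} {e : Sym2 (Fin n)}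
    (he : e.IsDiag) (hK : K e ≠ 0) : multLaw g {K} = 0 := by
  rw [multLaw, Measure.pi_singleton]
  refine Finset.prod_eq_zero (Finset.mem_univ e) ?_
  rw [PMF.toMeasure_apply_singleton _ _ (measurableSet_singleton _)]
  simp [edgeLaw, he, hK]

/-- Positivity is not visible in the algebraic definition; it comes from representing `condMoment`
as an integral against the law of an actual selection. -/
theorem Graphon.IsRegularSample.condMoment_mono {x : Fin n → I} (hx : W.IsRegularSample x)
    {p q : MvPolynomial (Sym2 (Fin n)) ℝ} (hpq : ∀ K : Sym2 (Fin n) → ℕ,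
      MvPolynomial.eval (fun e => (K e : ℝ)) p ≤ MvPolynomial.eval (fun e => (K e : ℝ)) q) :
    condMoment W x p ≤ condMoment W x q := by
  obtain ⟨g, hg⟩ := hx.exists_isSelection
  obtain ⟨h1, h2⟩ := multLaw_integral_eval hx hg p
  obtain ⟨h3, h4⟩ := multLaw_integral_eval hx hg q
  rw [← h2, ← h4]
  exact integral_mono h1 h3 hpq

theorem Graphon.IsProbabilityValued.meanMoment_mono (hW : W.IsProbabilityValued)
    {p q : MvPolynomial (Sym2 (Fin n)) ℝ} (hpq : ∀ K : Sym2 (Fin n) → ℕ,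
      MvPolynomial.eval (fun e => (K e : ℝ)) p ≤ MvPolynomial.eval (fun e => (K e : ℝ)) q) :
    meanMoment W p ≤ meanMoment W q := by
  refine integral_mono_ae (hW.integrable_condMoment p) (hW.integrable_condMoment q) ?_
  filter_upwards [hW.isRegularSample_ae n] with x hx
  exact hx.condMoment_mono hpq

theorem multLaw_lintegral_eval {x : Fin n → I} (hx : W.IsRegularSample x) {g : Pair n → ℕ → ℝ}
    (hg : IsSelection W x g) {p : MvPolynomial (Sym2 (Fin n)) ℝ}
    (hp : ∀ K : Sym2 (Fin n) → ℕ, 0 ≤ MvPolynomial.eval (fun e => (K e : ℝ)) p) :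
    ∫⁻ K, ENNReal.ofReal (MvPolynomial.eval (fun e => (K e : ℝ)) p) ∂(multLaw g) =
      ENNReal.ofReal (condMoment W x p) := by
  obtain ⟨h1, h2⟩ := multLaw_integral_eval hx hg p
  rw [← h2, ofReal_integral_eq_lintegral_ofReal h1 (Eventually.of_forall hp)]

end Laws

/-! ### Homomorphism densities as polynomials of the edge multiplicities -/

section HomPoly

/-- A homomorphism is a map of the nodes together with, for each edge, a choice among the parallel
edges between the images of its endpoints. -/
def Hom.equivSigma {V V' : Type*} (F : Multigraph V) (G : Multigraph V') :
    Hom F G ≃ Σ φ : V → V', ∀ e : F.Edge, Fin (G.mult (e.1.map φ)) where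
  toFun h := ⟨h.1.1, fun e => Fin.cast (congrArg G.mult (h.2 e)) (h.1.2 e).2⟩
  invFun u := ⟨(u.1, fun e => ⟨e.1.map u.1, u.2 e⟩), fun _ => rfl⟩
  left_inv h := by
    obtain ⟨⟨φ, ε⟩, hh⟩ := h
    refine Subtype.ext (Prod.ext rfl (funext fun e => ?_))
    have he := hh e
    refine Sigma.ext he.symm ?_
    simp only [Fin.heq_ext_iff (congrArg G.mult he.symm), Fin.val_cast]
  right_inv u := rfl

theorem card_hom {V V' : Type*} [Fintype V] [DecidableEq V] [Fintype V']
    (F : Multigraph V) (G : Multigraph V') :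
    Nat.card (Hom F G) = ∑ φ : V → V', ∏ e : Sym2 V, G.mult (e.map φ) ^ F.mult e := by
  rw [Nat.card_congr (Hom.equivSigma F G), Nat.card_eq_fintype_card, Fintype.card_sigma]
  refine Finset.sum_congr rfl fun φ _ => ?_
  rw [Fintype.card_pi, Fintype.prod_sigma]
  simp

variable {k n : ℕ}

/-- The number of homomorphisms `F → G` over the node map `φ`, as a polynomial of the edge
multiplicities of `G`. -/
def homPoly (F : Multigraph (Fin k)) (φ : Fin k → Fin n) : MvPolynomial (Sym2 (Fin n)) ℝ :=
  ∏ e : Sym2 (Fin k), MvPolynomial.X (e.map φ) ^ F.mult e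

/-- The difference of `t(F, G)` and `t`, as a polynomial of the edge multiplicities of `G`. -/
def deviationPoly (F : Multigraph (Fin k)) (t : ℝ) (n : ℕ) : MvPolynomial (Sym2 (Fin n)) ℝ :=
  ((n : ℝ) ^ k)⁻¹ • ∑ φ : Fin k → Fin n, (homPoly F φ - MvPolynomial.C t)

theorem eval_homPoly (F : Multigraph (Fin k)) (φ : Fin k → Fin n) (K : Sym2 (Fin n) → ℝ) :
    MvPolynomial.eval K (homPoly F φ) = ∏ e : Sym2 (Fin k), K (e.map φ) ^ F.mult e := by
  simp [homPoly]

theorem eval_deviationPoly (F : Multigraph (Fin k)) (t : ℝ) (hn : n ≠ 0)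
    (G : Multigraph (Fin n)) :
    MvPolynomial.eval (fun e => (G.mult e : ℝ)) (deviationPoly F t n) = homDensity F G - t := by
  have hn' : ((n : ℝ) ^ k) ≠ 0 := by positivity
  rw [homDensity, card_hom, deviationPoly, MvPolynomial.smul_eval, map_sum]
  simp only [map_sub, eval_homPoly, MvPolynomial.eval_C, Finset.sum_sub_distrib, Finset.sum_const,
    Finset.card_univ, Fintype.card_pi, Fintype.card_fin, Finset.prod_const, Nat.card_eq_fintype_card,
    nsmul_eq_mul, Nat.cast_pow, Nat.cast_sum, Nat.cast_prod]
  field_simp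

theorem homPoly_eq_monomial (F : Multigraph (Fin k)) (φ : Fin k → Fin n) :
    homPoly F φ = MvPolynomial.monomial
      (∑ e : Sym2 (Fin k), Finsupp.single (e.map φ) (F.mult e)) 1 := by
  rw [homPoly, MvPolynomial.monomial_sum_one]
  simp only [MvPolynomial.X_pow_eq_monomial]

theorem homPoly_mem_supported (F : Multigraph (Fin k)) (φ : Fin k → Fin n) {S : Set (Fin n)}
    (hS : ∀ i, φ i ∈ S) : homPoly F φ ∈ MvPolynomial.supported ℝ (pairsIn S) := by
  refine Subalgebra.prod_mem _ fun e _ => Subalgebra.pow_mem _ ?_ _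
  rw [MvPolynomial.X_mem_supported]
  intro i hi
  obtain ⟨j, -, rfl⟩ := Sym2.mem_map.1 hi
  exact hS j

variable {ρ : WeightFunction} {W : Graphon ρ}

/-- Injectivity keeps distinct pairs distinct and nondegenerate, so no exponents merge. -/
theorem condMoment_homPoly (F : Multigraph (Fin k)) {φ : Fin k → Fin n}
    (hφ : Function.Injective φ) (x : Fin n → I) :
    condMoment W x (homPoly F φ) = ∏ e : Sym2 (Fin k), W.moment (F.mult e) (e.map (x ∘ φ)) := by
  rw [homPoly_eq_monomial, condMoment_monomial, one_mul]
  symm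
  refine Fintype.prod_of_injective (Sym2.map φ) (Sym2.map.injective hφ) _ _ (fun e he => ?_)
    fun e => ?_
  · rw [Finsupp.finsetSum_apply, Finset.sum_eq_zero, edgeMoment_zero]
    intro e' _
    rw [Finsupp.single_apply, if_neg]
    rintro rfl
    exact he ⟨e', rfl⟩
  · rw [Finsupp.finsetSum_apply, Finset.sum_eq_single e]
    · rw [Finsupp.single_eq_same, edgeMoment]
      by_cases hd : e.IsDiag
      · rw [F.loopless e hd]
        simp
      · rw [if_neg, Sym2.map_map]
        rwa [Sym2.isDiag_map hφ]
    · intro e' _ he'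
      rw [Finsupp.single_apply, if_neg fun h => he' (Sym2.map.injective hφ h)]
    · simp

theorem Graphon.IsProbabilityValued.graphonDensity_eq (hW : W.IsProbabilityValued)
    (F : Multigraph (Fin k)) :
    graphonDensity F W = ∫ y : Fin k → I, ∏ e : Sym2 (Fin k), W.moment (F.mult e) (e.map y) := by
  refine integral_congr_ae ?_
  filter_upwards [hW.isRegularSample_ae k] with y hy
  rw [Finset.prod_filter]
  refine Finset.prod_congr rfl fun e _ => ?_
  by_cases he : F.mult e = 0
  · simp [he]
  · rw [if_pos he]
    exact ((hy ⟨e, fun h => he (F.loopless e h)⟩).2 _).symm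

theorem measurable_prod_moment (W : Graphon ρ) (F : Multigraph (Fin k)) :
    Measurable fun y : Fin k → I => ∏ e : Sym2 (Fin k), W.moment (F.mult e) (e.map y) := by
  refine Finset.measurable_fun_prod _ fun e _ => ?_
  induction e with
  | _ i j =>
    exact (W.measurable_moment (F.mult s(i, j))).comp
      (g := fun z : I × I => W.moment (F.mult s(i, j)) s(z.1, z.2))
      (f := fun y : Fin k → I => (y i, y j)) (by fun_prop)

theorem Graphon.IsProbabilityValued.meanMoment_homPoly (hW : W.IsProbabilityValued)
    (F : Multigraph (Fin k)) {φ : Fin k → Fin n} (hφ : Function.Injective φ) :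
    meanMoment W (homPoly F φ) = graphonDensity F W := by
  have hm := volume_map_comp_injective hφ
  rw [hW.graphonDensity_eq, ← hm.map_eq, integral_map hm.measurable.aemeasurable
    (measurable_prod_moment W F).aestronglyMeasurable]
  simp only [meanMoment, condMoment_homPoly F hφ]

/-! ### Uniform bounds for products of four deviations -/

/-- The product is at most the largest factor to the power `s.card`; the `1` is needed only for the
empty product. -/
theorem prod_le_one_add_sum_pow {ι : Type*} (s : Finset ι) {a : ι → ℝ} (ha : ∀ i, 0 ≤ a i) :
    ∏ i ∈ s, a i ≤ 1 + ∑ i ∈ s, a i ^ s.card := by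
  rcases s.eq_empty_or_nonempty with rfl | hs
  · simp
  · obtain ⟨j, hj, hmax⟩ := s.exists_max_image a hs
    have h1 : ∏ i ∈ s, a i ≤ a j ^ s.card := by
      rw [← Finset.prod_const]
      exact Finset.prod_le_prod (fun i _ => ha i) hmax
    have h2 : a j ^ s.card ≤ ∑ i ∈ s, a i ^ s.card :=
      Finset.single_le_sum (f := fun i => a i ^ s.card) (fun i _ => pow_nonneg (ha i) _) hj
    linarith

theorem abs_prod_four_le (z : Fin 4 → ℝ) : |∏ i, z i| ≤ ∑ i, z i ^ 4 := by
  simp only [Fin.prod_univ_four, Fin.sum_univ_four]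
  rw [abs_le]
  constructor <;>
  nlinarith [sq_nonneg (z 0 * z 1 - z 2 * z 3), sq_nonneg (z 0 * z 1 + z 2 * z 3),
    sq_nonneg (z 0 ^ 2 - z 1 ^ 2), sq_nonneg (z 2 ^ 2 - z 3 ^ 2), sq_nonneg (z 0 ^ 2),
    sq_nonneg (z 1 ^ 2), sq_nonneg (z 2 ^ 2), sq_nonneg (z 3 ^ 2)]

theorem sub_pow_four_le (a b : ℝ) : (a - b) ^ 4 ≤ 8 * (a ^ 4 + b ^ 4) := by
  nlinarith [sq_nonneg (a + b), sq_nonneg (a ^ 2 - b ^ 2), sq_nonneg (a - b),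
    mul_nonneg (sq_nonneg (a + b)) (sq_nonneg (a + b)),
    mul_nonneg (sq_nonneg (a + b)) (sq_nonneg (a - b)), sq_nonneg (a ^ 2 + b ^ 2 + 2 * a * b),
    sq_nonneg (a * b)]

/-- The bound is uniform in `n` and `e` because any two different points are jointly uniform on the
square; the `1` covers degenerate pairs. -/
theorem meanMoment_X_pow_le (W : Graphon ρ) (p : ℕ) :
    ∃ D, ∀ (n : ℕ) (e : Sym2 (Fin n)), meanMoment W (MvPolynomial.X e ^ p) ≤ D := by
  refine ⟨1 + |∫ z : I × I, W.moment p s(z.1, z.2)|, fun n e => ?_⟩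
  have h : ∀ x, condMoment W x (MvPolynomial.X e ^ p) = edgeMoment W x e p := by
    intro x
    rw [MvPolynomial.X_pow_eq_monomial, condMoment_monomial, one_mul, Finset.prod_eq_single e]
    · simp
    · intro e' _ he'
      rw [Finsupp.single_eq_of_ne he', edgeMoment_zero]
    · simp
  simp only [meanMoment, h, edgeMoment]
  induction e with
  | _ i j =>
    by_cases hd : s(i, j).IsDiag
    · simp only [hd, if_true, integral_const, probReal_univ, one_smul]
      have h1 : (0 : ℝ) ^ p ≤ 1 := pow_le_one₀ le_rfl zero_le_one
      have h2 := abs_nonneg (∫ z : I × I, W.moment p s(z.1, z.2))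
      linarith
    · simp only [hd, if_false, Sym2.map_mk]
      have hm := volume_map_eval_pair hd
      have h3 : ∫ x : Fin n → I, W.moment p s(x i, x j) = ∫ z : I × I, W.moment p s(z.1, z.2) := by
        rw [← hm.map_eq, integral_map hm.measurable.aemeasurable
          (W.measurable_moment p).aestronglyMeasurable]
      rw [h3]
      have h4 := le_abs_self (∫ z : I × I, W.moment p s(z.1, z.2))
      linarith

/-- Pointwise inequalities, transferred by `meanMoment_mono`, reduce the product to fourth powers of
single deviations and these to powers of single multiplicities. Non-injective maps, where edges of
`F` may merge, thus need no separate treatment. -/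
theorem Graphon.IsProbabilityValued.abs_meanMoment_prod_le (hW : W.IsProbabilityValued)
    (F : Multigraph (Fin k)) (t : ℝ) :
    ∃ B, ∀ (n : ℕ) (ψ : Fin 4 → Fin k → Fin n),
      |meanMoment W (∏ i, (homPoly F (ψ i) - MvPolynomial.C t))| ≤ B := by
  choose D hD using meanMoment_X_pow_le W
  set N := Fintype.card (Sym2 (Fin k)) with hN
  have hdev : ∀ (n : ℕ) (φ : Fin k → Fin n),
      meanMoment W ((homPoly F φ - MvPolynomial.C t) ^ 4) ≤
        8 * (1 + ∑ e : Sym2 (Fin k), D (F.mult e * 4 * N) + t ^ 4) := by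
    intro n φ
    set q : MvPolynomial (Sym2 (Fin n)) ℝ := (8 : ℝ) • (MvPolynomial.C (1 + t ^ 4) +
      ∑ e : Sym2 (Fin k), MvPolynomial.X (e.map φ) ^ (F.mult e * 4 * N)) with hq
    have h1 : meanMoment W ((homPoly F φ - MvPolynomial.C t) ^ 4) ≤ meanMoment W q := by
      refine hW.meanMoment_mono fun K => ?_
      have h2 := prod_le_one_add_sum_pow (Finset.univ : Finset (Sym2 (Fin k)))
        (a := fun e => ((K (e.map φ) : ℝ) ^ F.mult e) ^ 4) fun e => by positivity
      have h3 := sub_pow_four_le (∏ e : Sym2 (Fin k), (K (e.map φ) : ℝ) ^ F.mult e) t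
      simp only [hq, map_pow, map_sub, eval_homPoly, MvPolynomial.eval_C, MvPolynomial.smul_eval,
        map_add, map_sum, MvPolynomial.eval_X]
      rw [Finset.prod_pow, Finset.card_univ, ← hN] at h2
      simp only [← pow_mul] at h2
      linarith
    refine h1.trans ?_
    rw [hq, meanMoment_smul, hW.meanMoment_add, meanMoment_C, hW.meanMoment_sum]
    have h4 : ∑ e : Sym2 (Fin k), meanMoment W
        (MvPolynomial.X (e.map φ) ^ (F.mult e * 4 * N) : MvPolynomial (Sym2 (Fin n)) ℝ) ≤
        ∑ e : Sym2 (Fin k), D (F.mult e * 4 * N) := Finset.sum_le_sum fun e _ => hD _ _ _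
    linarith
  refine ⟨4 * (8 * (1 + ∑ e : Sym2 (Fin k), D (F.mult e * 4 * N) + t ^ 4)), fun n ψ => ?_⟩
  set q : MvPolynomial (Sym2 (Fin n)) ℝ := ∑ i, (homPoly F (ψ i) - MvPolynomial.C t) ^ 4 with hq
  have hqm : meanMoment W q ≤ 4 * (8 * (1 + ∑ e : Sym2 (Fin k), D (F.mult e * 4 * N) + t ^ 4)) := by
    rw [hq, hW.meanMoment_sum]
    refine (Finset.sum_le_sum fun i _ => hdev n (ψ i)).trans ?_
    simp
  have hpt : ∀ K : Sym2 (Fin n) → ℕ,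
      |MvPolynomial.eval (fun e => (K e : ℝ)) (∏ i, (homPoly F (ψ i) - MvPolynomial.C t))| ≤
        MvPolynomial.eval (fun e => (K e : ℝ)) q := by
    intro K
    rw [hq, map_prod, map_sum]
    simp only [map_pow]
    exact abs_prod_four_le _
  have h5 : meanMoment W (∏ i, (homPoly F (ψ i) - MvPolynomial.C t)) ≤ meanMoment W q :=
    hW.meanMoment_mono fun K => (abs_le.1 (hpt K)).2
  have h6 : meanMoment W ((-1 : ℝ) • q) ≤
      meanMoment W (∏ i, (homPoly F (ψ i) - MvPolynomial.C t)) :=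
    hW.meanMoment_mono fun K => by
      rw [MvPolynomial.smul_eval, neg_one_mul]
      exact (abs_le.1 (hpt K)).1
  rw [meanMoment_smul] at h6
  rw [abs_le]
  constructor <;> linarith

end HomPoly

/-! ### The fourth moment of the deviation -/

section FourthMoment

/-- Functions on `ι` with two prescribed coincidences are rare. -/
theorem card_coincidences_le {ι : Type*} [Fintype ι] [DecidableEq ι] {n : ℕ} {a b c d : ι}
    (hab : a ≠ b) (hca : c ≠ a) (hcb : c ≠ b) (hcd : c ≠ d) :
    (Finset.univ.filter fun f : ι → Fin n => f a = f b ∧ f c = f d).card * n ^ 2 ≤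
      n ^ Fintype.card ι := by
  have h : ((Finset.univ.filter fun f : ι → Fin n => f a = f b ∧ f c = f d) ×ˢ
      (Finset.univ : Finset (Fin n × Fin n))).card ≤
      (Finset.univ : Finset (ι → Fin n)).card := by
    -- Overwriting the values at `a` and `c` loses nothing: `b` is untouched and restores `f a`,
    -- after which `d` restores `f c`, even if `d = a`.
    refine Finset.card_le_card_of_injOn
      (fun z => Function.update (Function.update z.1 a z.2.1) c z.2.2) (by simp) ?_
    rintro ⟨f, u, v⟩ hf ⟨f', u', v'⟩ hf' heq
    simp only [Finset.coe_product, Finset.coe_filter, Finset.mem_univ, true_and, Set.mem_prod,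
      Set.mem_ofPred_eq, Finset.coe_univ, Set.mem_univ, and_true] at hf hf'
    have hpt : ∀ i, Function.update (Function.update f a u) c v i =
        Function.update (Function.update f' a u') c v' i := fun i => congrFun heq i
    have hv : v = v' := by simpa using hpt c
    have hu : u = u' := by simpa [Function.update_of_ne hca.symm] using hpt a
    have hoff : ∀ i, i ≠ a → i ≠ c → f i = f' i := fun i hia hic => by
      simpa [Function.update_of_ne hia, Function.update_of_ne hic] using hpt i
    have ha : f a = f' a := by rw [hf.1, hf'.1, hoff b hab.symm hcb.symm]
    have hc : f c = f' c := by
      rw [hf.2, hf'.2]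
      by_cases hda : d = a
      · rw [hda, ha]
      · exact hoff d hda hcd.symm
    have hff : f = f' := by
      funext i
      by_cases hia : i = a
      · rw [hia, ha]
      by_cases hic : i = c
      · rw [hic, hc]
      exact hoff i hia hic
    rw [hff, hu, hv]
  rw [Finset.card_product] at h
  simpa [sq] using h

variable {k n : ℕ}

/-- None of the four node maps is at once injective and disjoint from the other three. -/
def IsEntangled (ψ : Fin 4 → Fin k → Fin n) : Prop :=
  ∀ i, ∃ (a : Fin k) (b : Fin 4 × Fin k), (i, a) ≠ b ∧ ψ i a = ψ b.1 b.2

open scoped Classical in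
-- Map `0` has a coincidence with some slot `b`. A map `j` other than `0` and the map of `b` has a
-- coincidence too, and its slot is neither of the first two, so each of the two coincidences costs
-- a factor `n`. There are at most `(4 * k) ^ 4` choices of the four slots.
theorem card_isEntangled_le (k n : ℕ) :
    (Finset.univ.filter fun ψ : Fin 4 → Fin k → Fin n => IsEntangled ψ).card * n ^ 2 ≤
      (4 * k) ^ 4 * n ^ (4 * k) := by
  let ι := Fin 4 × Fin k
  let J : Finset (ι × ι × ι × ι) := Finset.univ.filter fun q =>
    q.1 ≠ q.2.1 ∧ q.2.2.1 ≠ q.1 ∧ q.2.2.1 ≠ q.2.1 ∧ q.2.2.1 ≠ q.2.2.2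
  let A : ι × ι × ι × ι → Finset (ι → Fin n) := fun q =>
    Finset.univ.filter fun f => f q.1 = f q.2.1 ∧ f q.2.2.1 = f q.2.2.2
  have h1 : (Finset.univ.filter fun ψ : Fin 4 → Fin k → Fin n => IsEntangled ψ).card ≤
      (J.biUnion A).card := by
    refine Finset.card_le_card_of_injOn (fun ψ => Function.uncurry ψ) ?_
      Function.uncurry_injective.injOn
    intro ψ hψ
    have hψ' : IsEntangled ψ := by simpa using hψ
    obtain ⟨a, b, hab, hab'⟩ := hψ' 0
    obtain ⟨j, hj0, hjb⟩ : ∃ j : Fin 4, j ≠ 0 ∧ j ≠ b.1 := by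
      generalize b.1 = m
      revert m
      decide
    obtain ⟨c, d, hcd, hcd'⟩ := hψ' j
    rw [Finset.mem_coe, Finset.mem_biUnion]
    refine ⟨((0, a), b, (j, c), d), ?_, ?_⟩
    · simp only [J, Finset.mem_filter, Finset.mem_univ, true_and]
      exact ⟨hab, fun h => hj0 (congrArg Prod.fst h), fun h => hjb (congrArg Prod.fst h), hcd⟩
    · simp only [A, Finset.mem_filter, Finset.mem_univ, true_and]
      exact ⟨hab', hcd'⟩
  have hι : Fintype.card ι = 4 * k := by simp [ι]
  calc (Finset.univ.filter fun ψ : Fin 4 → Fin k → Fin n => IsEntangled ψ).card * n ^ 2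
      ≤ (∑ q ∈ J, (A q).card) * n ^ 2 :=
        Nat.mul_le_mul_right _ (h1.trans Finset.card_biUnion_le)
    _ = ∑ q ∈ J, (A q).card * n ^ 2 := Finset.sum_mul _ _ _
    _ ≤ ∑ _q ∈ J, n ^ (4 * k) := by
        refine Finset.sum_le_sum fun q hq => ?_
        simp only [J, Finset.mem_filter, Finset.mem_univ, true_and] at hq
        rw [← hι]
        exact card_coincidences_le hq.1 hq.2.1 hq.2.2.1 hq.2.2.2
    _ = J.card * n ^ (4 * k) := by rw [Finset.sum_const, smul_eq_mul]
    _ ≤ (4 * k) ^ 4 * n ^ (4 * k) := by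
        refine Nat.mul_le_mul_right _ ((Finset.card_le_univ J).trans_eq ?_)
        simp only [ι, Fintype.card_prod, Fintype.card_fin]
        ring

variable {ρ : WeightFunction} {W : Graphon ρ}

/-- The factor of the isolated injective map splits off by independence and has mean zero. -/
theorem Graphon.IsProbabilityValued.meanMoment_prod_eq_zero (hW : W.IsProbabilityValued)
    (F : Multigraph (Fin k)) {ψ : Fin 4 → Fin k → Fin n} (hψ : ¬ IsEntangled ψ) :
    meanMoment W (∏ i, (homPoly F (ψ i) - MvPolynomial.C (graphonDensity F W))) = 0 := by
  simp only [IsEntangled, not_forall, not_exists, not_and] at hψ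
  obtain ⟨i, hi⟩ := hψ
  have hinj : Function.Injective (ψ i) := fun a b hab => by
    by_contra hne
    exact hi a (i, b) (fun h => hne (congrArg Prod.snd h)) hab
  let S : Finset (Fin n) := Finset.univ.image (ψ i)
  let T : Finset (Fin n) := (Finset.univ.erase i).biUnion fun j => Finset.univ.image (ψ j)
  have hST : Disjoint S T := by
    rw [Finset.disjoint_left]
    intro v hvS hvT
    simp only [S, T, Finset.mem_image, Finset.mem_biUnion, Finset.mem_univ, true_and,
      Finset.mem_erase, and_true] at hvS hvT
    obtain ⟨a, rfl⟩ := hvS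
    obtain ⟨j, hj, b, hb⟩ := hvT
    exact hi a (j, b) (fun h => hj (congrArg Prod.fst h).symm) hb.symm
  have hC : ∀ U : Set (Fin n), MvPolynomial.C (graphonDensity F W) ∈
      MvPolynomial.supported ℝ (pairsIn U) := fun U =>
    (MvPolynomial.supported ℝ (pairsIn U)).algebraMap_mem _
  rw [← Finset.mul_prod_erase Finset.univ _ (Finset.mem_univ i), meanMoment_mul W hST,
    hW.meanMoment_sub, hW.meanMoment_homPoly F hinj, meanMoment_C, sub_self, zero_mul]
  · exact Subalgebra.sub_mem _ (homPoly_mem_supported F _ fun a => by simp [S]) (hC _)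
  · refine Subalgebra.prod_mem _ fun j hj => Subalgebra.sub_mem _
      (homPoly_mem_supported F _ fun a => ?_) (hC _)
    simp only [T, Finset.coe_biUnion, Set.mem_iUnion]
    exact ⟨j, hj, by simp⟩

theorem Graphon.IsProbabilityValued.meanMoment_deviation_pow_four_le
    (hW : W.IsProbabilityValued) (F : Multigraph (Fin k)) :
    ∃ C, ∀ n : ℕ, n ≠ 0 →
      meanMoment W (deviationPoly F (graphonDensity F W) n ^ 4) ≤ C / (n : ℝ) ^ 2 := by
  classical
  obtain ⟨B, hB⟩ := hW.abs_meanMoment_prod_le F (graphonDensity F W)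
  refine ⟨(4 * k : ℝ) ^ 4 * B, fun n hn => ?_⟩
  have hn' : (0 : ℝ) < n := by positivity
  have hB0 : 0 ≤ B := (abs_nonneg _).trans (hB n fun _ _ => ⟨0, Nat.pos_of_ne_zero hn⟩)
  have hcard : ((Finset.univ.filter fun ψ : Fin 4 → Fin k → Fin n => IsEntangled ψ).card : ℝ) *
      (n : ℝ) ^ 2 ≤ (4 * k : ℝ) ^ 4 * (n : ℝ) ^ (4 * k) := by
    exact_mod_cast card_isEntangled_le k n
  rw [deviationPoly, smul_pow, Fintype.sum_pow, meanMoment_smul, hW.meanMoment_sum]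
  have h1 : ∑ ψ : Fin 4 → Fin k → Fin n, meanMoment W
      (∏ i, (homPoly F (ψ i) - MvPolynomial.C (graphonDensity F W))) ≤
      (Finset.univ.filter fun ψ : Fin 4 → Fin k → Fin n => IsEntangled ψ).card * B := by
    rw [← nsmul_eq_mul, ← Finset.sum_const, Finset.sum_filter]
    refine Finset.sum_le_sum fun ψ _ => ?_
    split_ifs with hψ
    · exact (le_abs_self _).trans (hB n ψ)
    · exact (hW.meanMoment_prod_eq_zero F hψ).le
  rw [le_div_iff₀ (by positivity), inv_pow, ← pow_mul, mul_comm k 4, mul_assoc,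
    inv_mul_le_iff₀ (by positivity)]
  calc _ ≤ ((Finset.univ.filter fun ψ : Fin 4 → Fin k → Fin n => IsEntangled ψ).card * B) *
        (n : ℝ) ^ 2 := by gcongr
    _ = ((Finset.univ.filter fun ψ : Fin 4 → Fin k → Fin n => IsEntangled ψ).card *
        (n : ℝ) ^ 2) * B := by ring
    _ ≤ ((4 * k : ℝ) ^ 4 * (n : ℝ) ^ (4 * k)) * B := by gcongr
    _ = _ := by ring

theorem Graphon.IsProbabilityValued.tsum_meanMoment_deviation_ne_top
    (hW : W.IsProbabilityValued) (F : Multigraph (Fin k)) :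
    ∑' n : ℕ, ENNReal.ofReal
      (meanMoment W (deviationPoly F (graphonDensity F W) n ^ 4)) ≠ ⊤ := by
  obtain ⟨C, hC⟩ := hW.meanMoment_deviation_pow_four_le F
  have hnn : ∀ n, 0 ≤ meanMoment W (deviationPoly F (graphonDensity F W) n ^ 4) := fun n => by
    have h := hW.meanMoment_mono (p := MvPolynomial.C 0)
      (q := deviationPoly F (graphonDensity F W) n ^ 4) fun K => by
        rw [MvPolynomial.eval_C, map_pow]
        positivity
    rwa [meanMoment_C] at h
  have hs : Summable fun n : ℕ => meanMoment W (deviationPoly F (graphonDensity F W) n ^ 4) := by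
    -- The bound says nothing about `n = 0`.
    rw [← summable_nat_add_iff 1]
    refine Summable.of_nonneg_of_le (fun n => hnn _) (fun n => hC (n + 1) n.succ_ne_zero) ?_
    have h2 : Summable fun n : ℕ => C / (n : ℝ) ^ 2 := by
      simp only [div_eq_mul_inv]
      exact (Real.summable_nat_pow_inv.2 one_lt_two).mul_left C
    exact (summable_nat_add_iff 1).2 h2
  rw [← ENNReal.ofReal_tsum_of_nonneg hnn hs]
  exact ENNReal.ofReal_ne_top

end FourthMoment

/-! ### Almost sure convergence -/

section Convergence

variable {k n : ℕ}

instance (k : ℕ) : Countable (Multigraph (Fin k)) :=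
  Function.Injective.countable (f := Multigraph.mult) fun _ _ h => Multigraph.ext h

theorem measurable_mult {Ω : Type*} [MeasurableSpace Ω] {M : Ω → Multigraph (Fin n)}
    (hM : ∀ e : Pair n, Measurable fun ω => (M ω).mult e) : Measurable fun ω => (M ω).mult := by
  refine measurable_pi_iff.2 fun e => ?_
  by_cases he : e.IsDiag
  · have h : (fun ω => (M ω).mult e) = fun _ => 0 := funext fun ω => (M ω).loopless e he
    rw [h]
    exact measurable_const
  · exact hM ⟨e, he⟩

/-- By Tonelli the sum of the fourth powers is integrable, hence almost surely finite, and its terms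
tend to zero. Only the law for each separate `n` enters the hypothesis. -/
theorem tendsto_homDensity_of_tsum_ne_top {Ω : Type*} [MeasurableSpace Ω] {P : Measure Ω}
    {M : (n : ℕ) → Ω → Multigraph (Fin n)}
    (hM : ∀ n, Measurable fun ω => (M n ω).mult) (F : Multigraph (Fin k)) {t : ℝ}
    (h : ∑' n, ∫⁻ ω, ENNReal.ofReal (MvPolynomial.eval (fun e => ((M n ω).mult e : ℝ))
      (deviationPoly F t n ^ 4)) ∂P ≠ ⊤) :
    ∀ᵐ ω ∂P, Tendsto (fun n => homDensity F (M n ω)) atTop (𝓝 t) := by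
  have hm : ∀ n, Measurable fun ω => ENNReal.ofReal
      (MvPolynomial.eval (fun e => ((M n ω).mult e : ℝ)) (deviationPoly F t n ^ 4)) := fun n =>
    (measurable_of_countable fun K : Sym2 (Fin n) → ℕ => ENNReal.ofReal
      (MvPolynomial.eval (fun e => (K e : ℝ)) (deviationPoly F t n ^ 4))).comp (hM n)
  rw [← lintegral_tsum fun n => (hm n).aemeasurable] at h
  filter_upwards [ae_lt_top (Measurable.tsum hm) h] with ω hω
  have h0 := ENNReal.tendsto_atTop_zero_of_tsum_ne_top hω.ne
  have h1 : Tendsto (fun n => (homDensity F (M n ω) - t) ^ 4) atTop (𝓝 0) := by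
    have h2 := (ENNReal.tendsto_toReal ENNReal.zero_ne_top).comp h0
    rw [ENNReal.toReal_zero] at h2
    refine h2.congr' ?_
    filter_upwards [eventually_ne_atTop 0] with n hn
    rw [Function.comp_apply, map_pow, eval_deviationPoly F t hn,
      ENNReal.toReal_ofReal (Even.pow_nonneg (by decide) _)]
  have h3 : Tendsto (fun n => |homDensity F (M n ω) - t|) atTop (𝓝 0) := by
    have h4 := (Real.continuous_sqrt.comp Real.continuous_sqrt).tendsto 0 |>.comp h1
    simp only [Function.comp_def, Real.sqrt_zero] at h4
    refine h4.congr fun n => ?_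
    rw [show (homDensity F (M n ω) - t) ^ 4 = ((homDensity F (M n ω) - t) ^ 2) ^ 2 by ring,
      Real.sqrt_sq (sq_nonneg _), Real.sqrt_sq_eq_abs]
  exact tendsto_iff_norm_sub_tendsto_zero.2 h3

/-! ### Laws of the random multigraphs -/

theorem preimage_mult_eq {Ω : Type*} (M : Ω → Multigraph (Fin n)) (K : Multigraph (Fin n)) :
    (fun ω => (M ω).mult) ⁻¹' {K.mult} = {ω | M ω = K} := by
  ext ω
  exact (Multigraph.ext_iff (x := M ω) (y := K)).symm

theorem preimage_mult_eq_empty {Ω : Type*} (M : Ω → Multigraph (Fin n)) {K : Sym2 (Fin n) → ℕ}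
    {e : Sym2 (Fin n)} (he : e.IsDiag) (hK : K e ≠ 0) :
    (fun ω => (M ω).mult) ⁻¹' {K} = ∅ := by
  refine Set.eq_empty_of_forall_notMem fun ω hω => hK ?_
  rw [← Set.mem_singleton_iff.1 hω]
  exact (M ω).loopless e he

theorem exists_mult_eq_or_loop (K : Sym2 (Fin n) → ℕ) :
    (∃ G : Multigraph (Fin n), G.mult = K) ∨ ∃ e : Sym2 (Fin n), e.IsDiag ∧ K e ≠ 0 := by
  by_cases h : ∀ e : Sym2 (Fin n), e.IsDiag → K e = 0
  · exact Or.inl ⟨⟨K, h⟩, rfl⟩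
  · push Not at h
    exact Or.inr h

theorem IsRandomization.map_mult {Ω : Type*} [MeasurableSpace Ω] {Q : Measure Ω}
    [IsProbabilityMeasure Q] {g : Pair n → ℕ → ℝ} (hg : ∀ e, IsDistribution (g e))
    {M : Ω → Multigraph (Fin n)} (hM : IsRandomization Q g M) :
    Q.map (fun ω => (M ω).mult) = multLaw g := by
  have hm := measurable_mult hM.measurable
  refine Measure.ext_of_singleton fun K => ?_
  rw [Measure.map_apply hm (measurableSet_singleton K)]
  rcases exists_mult_eq_or_loop K with ⟨G, rfl⟩ | ⟨e, he, hK⟩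
  · rw [multLaw_singleton hg, preimage_mult_eq]
    have h1 : {ω | M ω = G} = ⋂ e ∈ (Finset.univ : Finset (Pair n)),
        (fun ω => (M ω).mult e) ⁻¹' {G.mult e} := by
      ext ω
      simp only [Finset.mem_univ, Set.iInter_true, Set.mem_iInter, Set.mem_preimage,
        Set.mem_singleton_iff, Set.mem_ofPred_eq]
      refine ⟨fun h e => by rw [h], fun h => Multigraph.ext (funext fun e => ?_)⟩
      by_cases he : e.IsDiag
      · rw [G.loopless e he, (M ω).loopless e he]
      · exact h ⟨e, he⟩
    rw [h1, hM.indep.measure_inter_preimage_eq_mul _ fun e _ => measurableSet_singleton _,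
      ENNReal.ofReal_prod_of_nonneg fun e _ => (hg e).1 _]
    refine Finset.prod_congr rfl fun e _ => ?_
    rw [← hM.law e (G.mult e)]
    exact (ofReal_measureReal).symm
  · rw [preimage_mult_eq_empty M he hK, measure_empty, multLaw_singleton_of_loop he hK]

variable {ρ : WeightFunction} {W : Graphon ρ}

theorem IsRandomization.lintegral_eval {Ω : Type*} [MeasurableSpace Ω] {Q : Measure Ω}
    [IsProbabilityMeasure Q] {x : Fin n → I} (hx : W.IsRegularSample x) {g : Pair n → ℕ → ℝ}
    (hg : IsSelection W x g) {M : Ω → Multigraph (Fin n)} (hM : IsRandomization Q g M)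
    {p : MvPolynomial (Sym2 (Fin n)) ℝ}
    (hp : ∀ K : Sym2 (Fin n) → ℕ, 0 ≤ MvPolynomial.eval (fun e => (K e : ℝ)) p) :
    ∫⁻ ω, ENNReal.ofReal (MvPolynomial.eval (fun e => ((M ω).mult e : ℝ)) p) ∂Q =
      ENNReal.ofReal (condMoment W x p) := by
  rw [← multLaw_lintegral_eval hx hg hp, ← hM.map_mult fun e => (hg e).2,
    lintegral_map (measurable_of_countable _) (measurable_mult hM.measurable)]

/-- The selection is not assumed measurable. The mass of a loopless `K` is nevertheless a.e.
measurable, being almost surely equal to a conditional probability; the mass of any other `K` is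
`0`. -/
theorem IsGeneratedFrom.map_mult_singleton {Ω : Type*} {𝓖 : MeasurableSpace Ω}
    [mΩ : MeasurableSpace Ω] {P : Measure Ω} [IsProbabilityMeasure P] {x : Fin n → Ω → I}
    {g : Ω → Pair n → ℕ → ℝ} {M : Ω → Multigraph (Fin n)}
    (hM : IsGeneratedFrom 𝓖 P W x g M) (K : Sym2 (Fin n) → ℕ) :
    AEMeasurable (fun ω => multLaw (g ω) {K}) P ∧
      P.map (fun ω => (M ω).mult) {K} = ∫⁻ ω, multLaw (g ω) {K} ∂P := by
  have hm := measurable_mult hM.measurable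
  rw [Measure.map_apply hm (measurableSet_singleton K)]
  rcases exists_mult_eq_or_loop K with ⟨G, rfl⟩ | ⟨e, he, hK⟩
  · have hset : MeasurableSet {ω | M ω = G} := by
      rw [← preimage_mult_eq]
      exact hm (measurableSet_singleton _)
    have hae : (fun ω => multLaw (g ω) {G.mult}) =ᵐ[P] fun ω =>
        ENNReal.ofReal ((P[Set.indicator {ω | M ω = G} (fun _ => (1 : ℝ)) | 𝓖]) ω) := by
      filter_upwards [hM.selection, hM.condLaw G] with ω h1 h2
      rw [h2, multLaw_singleton fun e => (h1 e).2]
    have hi : Integrable (P[Set.indicator {ω | M ω = G} (fun _ => (1 : ℝ)) | 𝓖]) P :=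
      integrable_condExp
    refine ⟨(hi.aestronglyMeasurable.aemeasurable.ennreal_ofReal).congr hae.symm, ?_⟩
    have hnn : 0 ≤ᵐ[P] P[Set.indicator {ω | M ω = G} (fun _ => (1 : ℝ)) | 𝓖] :=
      condExp_nonneg (Eventually.of_forall fun ω =>
        Set.indicator_nonneg (fun _ _ => zero_le_one) ω)
    rw [lintegral_congr_ae hae, ← ofReal_integral_eq_lintegral_ofReal hi hnn,
      integral_condExp hM.le, integral_indicator hset, preimage_mult_eq]
    simp
  · simp only [multLaw_singleton_of_loop he hK]
    exact ⟨aemeasurable_const, by rw [preimage_mult_eq_empty M he hK]; simp⟩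

theorem IsGeneratedFrom.measurable_mult {Ω : Type*} {𝓖 mΩ : MeasurableSpace Ω} {P : Measure Ω}
    {x : Fin n → Ω → I} {g : Ω → Pair n → ℕ → ℝ} {M : Ω → Multigraph (Fin n)}
    (hM : IsGeneratedFrom 𝓖 P W x g M) : Measurable fun ω => (M ω).mult :=
  MultigraphLimit.measurable_mult hM.measurable

/-- Since only the masses of single configurations are known to be a.e. measurable, the conditioning
is done by summing over the countably many configurations. -/
theorem IsGeneratedFrom.lintegral_eval (hW : W.IsProbabilityValued) {Ω : Type*}
    {𝓖 mΩ : MeasurableSpace Ω} {P : Measure Ω} [IsProbabilityMeasure P]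
    {x : Fin n → Ω → I} {g : Ω → Pair n → ℕ → ℝ} {M : Ω → Multigraph (Fin n)}
    (hM : IsGeneratedFrom 𝓖 P W x g M) {p : MvPolynomial (Sym2 (Fin n)) ℝ}
    (hp : ∀ K : Sym2 (Fin n) → ℕ, 0 ≤ MvPolynomial.eval (fun e => (K e : ℝ)) p) :
    ∫⁻ ω, ENNReal.ofReal (MvPolynomial.eval (fun e => ((M ω).mult e : ℝ)) p) ∂P =
      ENNReal.ofReal (meanMoment W p) := by
  set f : (Sym2 (Fin n) → ℕ) → ENNReal :=
    fun K => ENNReal.ofReal (MvPolynomial.eval (fun e => (K e : ℝ)) p) with hf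
  have hmp := hM.sample.measurePreserving
  have hreg : ∀ᵐ ω ∂P, W.IsRegularSample fun i => x i ω :=
    hmp.quasiMeasurePreserving.ae (hW.isRegularSample_ae n)
  have hnn : ∀ᵐ y : Fin n → I, 0 ≤ condMoment W y p := by
    filter_upwards [hW.isRegularSample_ae n] with y hy
    have h := hy.condMoment_mono (p := MvPolynomial.C 0) (q := p) fun K => by
      rw [MvPolynomial.eval_C]
      exact hp K
    rwa [condMoment_C] at h
  calc ∫⁻ ω, f (M ω).mult ∂P
      = ∫⁻ K, f K ∂(P.map fun ω => (M ω).mult) :=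
        (lintegral_map (measurable_of_countable f) hM.measurable_mult).symm
    _ = ∑' K, f K * ∫⁻ ω, multLaw (g ω) {K} ∂P := by
        rw [lintegral_countable']
        simp only [(hM.map_mult_singleton _).2]
    _ = ∑' K, ∫⁻ ω, f K * multLaw (g ω) {K} ∂P :=
        tsum_congr fun K => (lintegral_const_mul'' _ (hM.map_mult_singleton K).1).symm
    _ = ∫⁻ ω, ∑' K, f K * multLaw (g ω) {K} ∂P :=
        (lintegral_tsum fun K => (hM.map_mult_singleton K).1.const_mul _).symm
    _ = ∫⁻ ω, ENNReal.ofReal (condMoment W (fun i => x i ω) p) ∂P := by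
        refine lintegral_congr_ae ?_
        filter_upwards [hreg, hM.selection] with ω h1 h2
        rw [← multLaw_lintegral_eval h1 h2 hp, lintegral_countable']
    _ = ∫⁻ y : Fin n → I, ENNReal.ofReal (condMoment W y p) :=
        hmp.lintegral_comp (f := fun y => ENNReal.ofReal (condMoment W y p))
          (measurable_condMoment W p).ennreal_ofReal
    _ = ENNReal.ofReal (meanMoment W p) :=
        (ofReal_integral_eq_lintegral_ofReal (hW.integrable_condMoment p) hnn).symm

theorem eval_pow_four_nonneg (p : MvPolynomial (Sym2 (Fin n)) ℝ) (K : Sym2 (Fin n) → ℕ) :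
    0 ≤ MvPolynomial.eval (fun e => (K e : ℝ)) (p ^ 4) := by
  rw [map_pow]
  exact Even.pow_nonneg (by decide) _

/-- The `W`-random multigraphs converge to `W` almost surely, whatever their joint law. -/
theorem Graphon.IsProbabilityValued.ae_tendsto_random (hW : W.IsProbabilityValued) {Ω : Type*}
    [MeasurableSpace Ω] (P : Measure Ω) [IsProbabilityMeasure P]
    (M : (n : ℕ) → Ω → Multigraph (Fin n)) (hM : ∀ n, IsWRandomMultigraph P W (M n))
    (F : Multigraph (Fin k)) :
    ∀ᵐ ω ∂P, Tendsto (fun n => homDensity F (M n ω)) atTop (𝓝 (graphonDensity F W)) := by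
  refine tendsto_homDensity_of_tsum_ne_top (fun n => ?_) F ?_
  · obtain ⟨𝓖, x, g, h⟩ := hM n
    exact h.measurable_mult
  · convert hW.tsum_meanMoment_deviation_ne_top F using 3 with n
    obtain ⟨𝓖, x, g, h⟩ := hM n
    exact h.lintegral_eval hW (eval_pow_four_nonneg _)

/-- For almost every choice of the points, the regularity of the samples and the summability of the
conditional fourth moments of the deviation hold. -/
theorem Graphon.IsProbabilityValued.ae_sample (hW : W.IsProbabilityValued) {Ω : Type*}
    [MeasurableSpace Ω] (P : Measure Ω) [IsProbabilityMeasure P]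
    (x : (n : ℕ) → Fin n → Ω → I) (hx : ∀ n, IsUniformSample P (x n))
    (F : Multigraph (Fin k)) :
    ∀ᵐ ω ∂P, (∀ n, W.IsRegularSample fun i => x n i ω) ∧
      ∑' n, ENNReal.ofReal (condMoment W (fun i => x n i ω)
        (deviationPoly F (graphonDensity F W) n ^ 4)) ≠ ⊤ := by
  have hreg : ∀ᵐ ω ∂P, ∀ n, W.IsRegularSample fun i => x n i ω :=
    ae_all_iff.2 fun n =>
      (hx n).measurePreserving.quasiMeasurePreserving.ae (hW.isRegularSample_ae n)
  let p : (n : ℕ) → MvPolynomial (Sym2 (Fin n)) ℝ := fun n =>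
    deviationPoly F (graphonDensity F W) n ^ 4
  have hmeas : ∀ n, Measurable fun y : Fin n → I => ENNReal.ofReal (condMoment W y (p n)) :=
    fun n => (measurable_condMoment W (p n)).ennreal_ofReal
  have hmeas' : ∀ n, Measurable fun ω => ENNReal.ofReal (condMoment W (fun i => x n i ω) (p n)) :=
    fun n => (hmeas n).comp (hx n).measurePreserving.measurable
  -- The expected sum of the conditional fourth moments is the sum of the fourth moments. It
  -- involves the points alone, so the null set is fixed before any selection.
  have hint : ∫⁻ ω, ∑' n, ENNReal.ofReal (condMoment W (fun i => x n i ω) (p n)) ∂P ≠ ⊤ := by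
    rw [lintegral_tsum fun n => (hmeas' n).aemeasurable]
    convert hW.tsum_meanMoment_deviation_ne_top F using 3 with n
    rw [(hx n).measurePreserving.lintegral_comp (hmeas n)]
    refine (ofReal_integral_eq_lintegral_ofReal (hW.integrable_condMoment (p n)) ?_).symm
    filter_upwards [hW.isRegularSample_ae n] with y hy
    have h := hy.condMoment_mono (p := MvPolynomial.C 0) (q := p n) fun K => by
      rw [MvPolynomial.eval_C]
      exact eval_pow_four_nonneg _ K
    rwa [condMoment_C] at h
  filter_upwards [hreg, ae_lt_top (Measurable.tsum hmeas') hint] with ω h1 h2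
  exact ⟨h1, h2.ne⟩

/-- If the points are regular and the conditional fourth moments are summable, then the
randomizations of every selection converge almost surely. -/
theorem ae_tendsto_randomization {x : (n : ℕ) → Fin n → I}
    (hreg : ∀ n, W.IsRegularSample (x n)) (F : Multigraph (Fin k))
    (hsum : ∑' n, ENNReal.ofReal (condMoment W (x n)
      (deviationPoly F (graphonDensity F W) n ^ 4)) ≠ ⊤)
    {g : (n : ℕ) → Pair n → ℕ → ℝ} (hg : ∀ n, IsSelection W (x n) (g n)) {Ω : Type*}
    [MeasurableSpace Ω] (Q : Measure Ω) [IsProbabilityMeasure Q]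
    {M : (n : ℕ) → Ω → Multigraph (Fin n)} (hM : ∀ n, IsRandomization Q (g n) (M n)) :
    ∀ᵐ ω ∂Q, Tendsto (fun n => homDensity F (M n ω)) atTop (𝓝 (graphonDensity F W)) := by
  refine tendsto_homDensity_of_tsum_ne_top (fun n => measurable_mult (hM n).measurable) F ?_
  simp only [fun n => (hM n).lintegral_eval (hreg n) (hg n)
    (eval_pow_four_nonneg (deviationPoly F (graphonDensity F W) n))]
  exact hsum

/-! ### Existence of randomizations and of a convergent sequence -/

/-- The multigraph with prescribed multiplicities of the pairs. -/
def Multigraph.ofPairs (K : Pair n → ℕ) : Multigraph (Fin n) where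
  mult e := if h : e.IsDiag then 0 else K ⟨e, h⟩
  loopless e he := by simp [he]

theorem Multigraph.ofPairs_mult (K : Pair n → ℕ) (e : Pair n) :
    (Multigraph.ofPairs K).mult e = K e := by
  simp [Multigraph.ofPairs, e.2]

/-- Independent randomizations of a sequence of decorations exist. -/
theorem exists_isRandomization {g : (n : ℕ) → Pair n → ℕ → ℝ}
    (hg : ∀ n e, IsDistribution (g n e)) :
    ∃ (Q : Measure ((Σ n, Pair n) → ℕ)) (_ : IsProbabilityMeasure Q)
      (M : (n : ℕ) → ((Σ n, Pair n) → ℕ) → Multigraph (Fin n)),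
      ∀ n, IsRandomization Q (g n) (M n) := by
  let μ : (Σ n, Pair n) → Measure ℕ := fun s => (distLaw (g s.1 s.2)).toMeasure
  refine ⟨Measure.infinitePi μ, inferInstance,
    fun n ω => Multigraph.ofPairs fun e => ω ⟨n, e⟩, fun n => ⟨fun e => ?_, fun e m => ?_, ?_⟩⟩
  · simp only [Multigraph.ofPairs_mult]
    exact measurable_pi_apply _
  · simp only [Multigraph.ofPairs_mult]
    have h := (measurePreserving_eval_infinitePi μ ⟨n, e⟩).measureReal_preimage
      (measurableSet_singleton m).nullMeasurableSet
    refine h.trans ?_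
    rw [measureReal_def, PMF.toMeasure_apply_singleton _ _ (measurableSet_singleton m),
      distLaw_apply (hg n e), ENNReal.toReal_ofReal ((hg n e).1 m)]
  · simp only [Multigraph.ofPairs_mult]
    have h : iIndepFun (fun (s : Σ n, Pair n) (ω : (Σ n, Pair n) → ℕ) => ω s)
        (Measure.infinitePi μ) :=
      iIndepFun_infinitePi (P := μ) (X := fun _ => id) fun _ => measurable_id
    exact h.precomp (g := fun e : Pair n => (⟨n, e⟩ : Σ n, Pair n)) sigma_mk_injective

/-- Initial segments of a sequence of independent uniform points. -/
theorem isUniformSample_infinitePi (n : ℕ) :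
    IsUniformSample (Measure.infinitePi fun _ : ℕ => (volume : Measure I))
      (fun (i : Fin n) (ω : ℕ → I) => ω i) where
  measurable i := measurable_pi_apply _
  uniform i := (measurePreserving_eval_infinitePi (fun _ : ℕ => (volume : Measure I)) i).map_eq
  indep := by
    have h : iIndepFun (fun (i : ℕ) (ω : ℕ → I) => ω i)
        (Measure.infinitePi fun _ : ℕ => (volume : Measure I)) :=
      iIndepFun_infinitePi (P := fun _ : ℕ => (volume : Measure I)) (X := fun _ => id)
        fun _ => measurable_id
    exact h.precomp (g := fun i : Fin n => (i : ℕ)) Fin.val_injective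

/-- Every probability-valued graphon is a limit of multigraphs. -/
theorem Graphon.IsProbabilityValued.exists_tendsto (hW : W.IsProbabilityValued) :
    ∃ G : (n : ℕ) → Multigraph (Fin n), ∀ {k : ℕ} (F : Multigraph (Fin k)),
      Tendsto (fun n => homDensity F (G n)) atTop (𝓝 (graphonDensity F W)) := by
  have h1 : ∀ᵐ ω ∂(Measure.infinitePi fun _ : ℕ => (volume : Measure I)),
      ∀ (k : ℕ) (F : Multigraph (Fin k)), (∀ n, W.IsRegularSample fun i : Fin n => ω i) ∧
        ∑' n, ENNReal.ofReal (condMoment W (fun i : Fin n => ω i)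
          (deviationPoly F (graphonDensity F W) n ^ 4)) ≠ ⊤ :=
    ae_all_iff.2 fun k => ae_all_iff.2 fun F =>
      hW.ae_sample _ (fun n (i : Fin n) (ω : ℕ → I) => ω i) isUniformSample_infinitePi F
  obtain ⟨ω, hω⟩ := h1.exists
  -- Regularity does not depend on `F`; the multigraph without nodes serves to extract it.
  have hreg := (hω 0 ⟨fun _ => 0, fun _ _ => rfl⟩).1
  choose g hg using fun n => (hreg n).exists_isSelection
  obtain ⟨Q, hQ, M, hM⟩ := exists_isRandomization fun n e => (hg n e).2
  have h2 : ∀ᵐ ω' ∂Q, ∀ (k : ℕ) (F : Multigraph (Fin k)),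
      Tendsto (fun n => homDensity F (M n ω')) atTop (𝓝 (graphonDensity F W)) :=
    ae_all_iff.2 fun k => ae_all_iff.2 fun F =>
      ae_tendsto_randomization hreg F (hω k F).2 hg Q hM
  obtain ⟨ω', hω'⟩ := h2.exists
  exact ⟨fun n => M n ω', fun F => hω' _ F⟩

end Convergence

end MultigraphLimit

end

theorem mainTheorem10 (ρ : WeightFunction) (W : Graphon ρ)
    (hW : W.IsProbabilityValued) :
    -- the random multigraphs converge almost surely, whatever the joint law for different `n`
    (∀ {Ω : Type*} [MeasurableSpace Ω] (P : Measure Ω) [IsProbabilityMeasure P]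
      (M : (n : ℕ) → Ω → Multigraph (Fin n)),
      (∀ n, IsWRandomMultigraph P W (M n)) →
      ∀ {k : ℕ} (F : Multigraph (Fin k)),
        ∀ᵐ ω ∂P, Tendsto (fun n => homDensity F (M n ω)) atTop (𝓝 (graphonDensity F W))) ∧
    -- for almost every choice of the points, this holds for an arbitrary (not necessarily
    -- measurable) adversarial selection of the distributions
    (∀ {Ω : Type*} [MeasurableSpace Ω] (P : Measure Ω) [IsProbabilityMeasure P]
      (x : (n : ℕ) → Fin n → Ω → I), (∀ n, IsUniformSample P (x n)) →
      ∀ {k : ℕ} (F : Multigraph (Fin k)), ∀ᵐ ω ∂P,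
        ∀ g : (n : ℕ) → Pair n → ℕ → ℝ, (∀ n, IsSelection W (fun i => x n i ω) (g n)) →
        ∀ {Ω' : Type*} [MeasurableSpace Ω'] (Q : Measure Ω') [IsProbabilityMeasure Q]
          (M : (n : ℕ) → Ω' → Multigraph (Fin n)), (∀ n, IsRandomization Q (g n) (M n)) →
          ∀ᵐ ω' ∂Q,
            Tendsto (fun n => homDensity F (M n ω')) atTop (𝓝 (graphonDensity F W))) ∧
    -- `W` is a limit of multigraphs
    (∃ G : (n : ℕ) → Multigraph (Fin n), ∀ {k : ℕ} (F : Multigraph (Fin k)),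
      Tendsto (fun n => homDensity F (G n)) atTop (𝓝 (graphonDensity F W))) := by
  refine ⟨fun P _ M hM _ F => hW.ae_tendsto_random P M hM F, ?_, hW.exists_tendsto⟩
  intro Ω _ P _ x hx k F
  -- The exceptional set depends on `F` and the points, but not on `g`, `Q` or `M`.
  filter_upwards [hW.ae_sample P x hx F] with ω hω g hg Ω' _ Q _ M hM
  exact ae_tendsto_randomization hω.1 F hω.2 hg Q hM
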